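/- Let $R\ge 2$ and $d\ge 2$. Robots $1,\dots,R$ have configuration space $\mathbb C_i=[0,1]^d$, (measurable) free spaces $\mathbb C_i^{\mathrm f}\subseteq[0,1]^d$, and for $i\ne j$ and each configuration $q_j$ of robot $j$ a set $I_i^j(q_j)\subseteq[0,1]^d$ of configurations of robot $i$ colliding with robot $j$ at $q_j$. Let $\mathbb C=\prod_i\mathbb C_i\subset\mathbb R^{Rd}$, let $\mathbb C^{\mathrm f}$ be the set of $Q=(q_1,\dots,q_R)\in\mathbb C$ with $q_i\in\mathbb C^{\mathrm f}_i$ for all $i$ and $q_i\notin I_i^j(q_j)$, $q_j\notin I_j^i(q_i)$ for all $i<j$, and let $\mathbb C^{\mathrm o}=\mathbb C\setminus\mathbb C^{\mathrm f}$. A (continuous) trajectory $\Sigma=(\sigma_1,\dots,\sigma_R):[0,1]\to\mathbb C^{\mathrm f}$ is robust if for some $\delta>0$ one has $\|\Sigma(\tau)-X\|\ge\delta$ for all $\tau\in[0,1]$ and $X\in\mathbb C^{\mathrm o}$. Let $\mathrm{cost}(\Sigma)$ be one of $\sum_i\|\sigma_i\|$, $\max_i\|\sigma_i\|$, or $\|\Sigma\|$,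 where $\|\cdot\|$ of a curve is its Euclidean arc length. Fix a query $S=(s_1,\dots,s_R)$, $T=(t_1,\dots,t_R)$ for which some robust trajectory from $S$ to $T$ exists. A value $c>0$ is robust if for every $\epsilon>0$ there is a robust trajectory $\Sigma$ from $S$ to $T$ with $\mathrm{cost}(\Sigma)\le(1+\epsilon)c$; the robust optimum $c^*$ is the infimum of all robust values. For every $n\geq 1$ and $i$ let $\mathbb G_i$ be the graph whose vertices are $s_i$, $t_i$ and $n$ independent uniform samples from $\mathbb C_i^{\mathrm f}$, with an edge between two vertices at distance less than $r(n)$ whenever the segment joining them lies in $\mathbb C_i^{\mathrm f}$. The tensor-product roadmap $\hat{\mathbb G}$ has as vertices the tuples $(v_1,\dots,v_R)$ of vertices $v_i$ of $\mathbb G_i$; $(V,V')$ is an edge if for every $i$ either $v_i=v_i'$ or $(v_i,v_i')$ is an edge of $\mathbb G_i$, and along an edge all robots move simultaneously and linearly. Suppose that, for some $\eta>0$ and all $n\geq 1$, $$r(n)\ \ge\ \gamma\Big(\frac{\log n}{n}\Big)^{1/d},\qquad \gamma=(1+\eta)\,2\,\Big(\frac1d\Big)^{1/d}\Big(\frac{\max_i\mu(\mathbb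 C_i^{\mathrm f})}{\zeta_d}\Big)^{1/d},$$ where $\mu$ is the volume (Lebesgue) measure on $\mathbb R^d$ and $\zeta_d$ is the volume of the unit ball in $\mathbb R^d$. Then $\hat{\mathbb G}$ is asymptotically optimal for each of the three costs: for every $\epsilon>0$, with probability tending to $1$ as $n\to\infty$, there is a lowest-cost path $\Sigma^{(n)}$ from $S$ to $T$ over $\hat{\mathbb G}$ among those contained in $\mathbb C^{\mathrm f}$, and $\mathrm{cost}(\Sigma^{(n)})\le(1+\epsilon)c^*$. -/

import Mathlib

open Set Filter Topology MeasureTheory ProbabilityTheory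
open scoped ENNReal unitInterval

noncomputable section

/-- Configurations of a single robot live in `ℝ^d` with its Euclidean norm. -/
abbrev Config (d : ℕ) : Type := EuclideanSpace ℝ (Fin d)

/-- Composite configurations `Q = (q_1, …, q_R)`; the norm is the Euclidean norm of `ℝ^(R d)`. -/
abbrev Composite (R d : ℕ) : Type := PiLp 2 (fun _ : Fin R => Config d)

/-- The configuration space `[0,1]^d` of a single robot. -/
def cube (d : ℕ) : Set (Config d) := {q | ∀ k, q k ∈ Icc (0 : ℝ) 1}

/-- The data of a multi-robot planning problem without the query: the free space of every robot,
and the sets `interference i j q` of configurations of robot `i` that collide with robot `j`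
at its configuration `q`. -/
structure MultiRobotSystem (R d : ℕ) where
  free : Fin R → Set (Config d)
  free_subset_cube : ∀ i, free i ⊆ cube d
  measurableSet_free : ∀ i, MeasurableSet (free i)
  interference : Fin R → Fin R → Config d → Set (Config d)
  interference_subset_cube : ∀ i j q, interference i j q ⊆ cube d

/-- The composite configuration space, the product of the cubes. -/
def compositeCube (R d : ℕ) : Set (Composite R d) := {Q | ∀ i, Q i ∈ cube d}

/-! ### Cost functions -/

/-- Arc length of a curve parametrized by `[0,1]`: the supremum, over all finite partitions, of the
length of the inscribed polygon. -/
def arcLength {X : Type*} [PseudoEMetricSpace X] (f : I → X) : ℝ≥0∞ := eVariationOn f univ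

/-- The sum of the path lengths of the robots. -/
def sumLengthCost {R d : ℕ} (f : I → Composite R d) : ℝ≥0∞ := ∑ i, arcLength (fun τ => f τ i)

/-- The maximum of the path lengths of the robots. -/
def maxLengthCost {R d : ℕ} (f : I → Composite R d) : ℝ≥0∞ := ⨆ i, arcLength (fun τ => f τ i)

/-- The Euclidean arc length of the composite trajectory. -/
def euclideanLengthCost {R d : ℕ} (f : I → Composite R d) : ℝ≥0∞ := arcLength f

namespace MultiRobotSystem

variable {R d : ℕ} (M : MultiRobotSystem R d)

/-- The composite free space: no collision with obstacles and no pairwise collision. -/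
def compositeFree : Set (Composite R d) :=
  {Q | (∀ i, Q i ∈ M.free i) ∧
    ∀ i j, i < j → Q i ∉ M.interference i j (Q j) ∧ Q j ∉ M.interference j i (Q i)}

/-- The composite obstacle space. -/
def compositeObstacle : Set (Composite R d) := compositeCube R d \ M.compositeFree

/-! ### Robust trajectories and the robust optimum -/

/-- A trajectory in the composite free space with a positive clearance from the obstacle space. -/
def IsRobust {S T : Composite R d} (Sig : Path S T) : Prop :=
  (∀ τ, Sig τ ∈ M.compositeFree) ∧
    ∃ δ : ℝ, 0 < δ ∧ ∀ τ, ∀ X ∈ M.compositeObstacle, δ ≤ ‖Sig τ - X‖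

/-- A value `c > 0` is robust for the query `(S, T)` if it is approximated, up to every factor
`1 + ε`, by the cost of a robust trajectory from `S` to `T`. -/
def IsRobustValue (cost : (I → Composite R d) → ℝ≥0∞) (S T : Composite R d) (c : ℝ) : Prop :=
  0 < c ∧ ∀ ε : ℝ, 0 < ε →
    ∃ Sig : Path S T, M.IsRobust Sig ∧ cost Sig ≤ ENNReal.ofReal ((1 + ε) * c)

/-- The robust optimum `c*`: the infimum of all robust values. -/
def robustOptimum (cost : (I → Composite R d) → ℝ≥0∞) (S T : Composite R d) : ℝ≥0∞ :=
  ⨅ (c : ℝ) (_ : M.IsRobustValue cost S T c), ENNReal.ofReal c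

/-! ### Single-robot roadmaps and the tensor-product roadmap -/

/-- The vertices of a single-robot roadmap: the start, the target and the samples. -/
def prmVertices (s t : Config d) {n : ℕ} (x : Fin n → Config d) : Set (Config d) :=
  {s, t} ∪ range x

/-- The edge relation of the roadmap of robot `i`: distinct vertices at distance less than the
connection radius `ρ`, joined by a collision-free segment. -/
def prmEdge (i : Fin R) (s t : Config d) {n : ℕ} (x : Fin n → Config d) (ρ : ℝ)
    (v w : Config d) : Prop :=
  v ∈ prmVertices s t x ∧ w ∈ prmVertices s t x ∧ v ≠ w ∧ dist v w < ρ ∧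
    segment ℝ v w ⊆ M.free i

/-- The vertices of the tensor-product roadmap. -/
def tensorVertices (S T : Composite R d) {n : ℕ} (x : Fin R → Fin n → Config d) :
    Set (Composite R d) :=
  {V | ∀ i, V i ∈ prmVertices (S i) (T i) (x i)}

/-- The edge relation of the tensor-product roadmap: every robot stays or moves along an edge
of its own roadmap. -/
def tensorEdge (S T : Composite R d) {n : ℕ} (x : Fin R → Fin n → Config d) (ρ : ℝ)
    (V W : Composite R d) : Prop :=
  V ∈ tensorVertices S T x ∧ W ∈ tensorVertices S T x ∧
    ∀ i, V i = W i ∨ M.prmEdge i (S i) (T i) (x i) ρ (V i) (W i)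

/-- A path from `S` to `T` over the tensor-product roadmap: a collision-free trajectory (with
respect to obstacles and between robots) that follows a chain `V 0, …, V m` of consecutively
adjacent vertices, all robots moving simultaneously and linearly along each edge. -/
def IsRoadmapPath {S T : Composite R d} {n : ℕ} (x : Fin R → Fin n → Config d) (ρ : ℝ)
    (Sig : Path S T) : Prop :=
  (∀ τ, Sig τ ∈ M.compositeFree) ∧
    ∃ (m : ℕ) (V : ℕ → Composite R d) (u : ℕ → ℝ),
      u 0 = 0 ∧ u m = 1 ∧ ∀ k < m, u k < u (k + 1) ∧ M.tensorEdge S T x ρ (V k) (V (k + 1)) ∧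
        ∀ τ : I, u k ≤ τ → (τ : ℝ) ≤ u (k + 1) →
          Sig τ = AffineMap.lineMap (V k) (V (k + 1)) (((τ : ℝ) - u k) / (u (k + 1) - u k))

/-- A lowest-cost path from `S` to `T` over the tensor-product roadmap. -/
def IsLowestCostPath (cost : (I → Composite R d) → ℝ≥0∞) {S T : Composite R d} {n : ℕ}
    (x : Fin R → Fin n → Config d) (ρ : ℝ) (Sig : Path S T) : Prop :=
  M.IsRoadmapPath x ρ Sig ∧ ∀ Sig' : Path S T, M.IsRoadmapPath x ρ Sig' → cost Sig ≤ cost Sig'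

/-! ### Random roadmaps -/

/-- For every `n` and every robot `i`, the `n` samples `X n i 0, …, X n i (n-1)` are independent
and uniformly distributed on the free space of robot `i`. -/
structure IsUniformSampling {Ω : Type*} [MeasurableSpace Ω] (P : Measure Ω)
    (X : (n : ℕ) → Fin R → Fin n → Ω → Config d) : Prop where
  measurable : ∀ n i k, Measurable (X n i k)
  uniform : ∀ n i k, pdf.IsUniform (X n i k) (M.free i) P volume
  indep : ∀ n i, iIndepFun (X n i) P

end MultiRobotSystem

/-- The events `E n` occur asymptotically almost surely. For measurable events this says
`P (E n) → 1`; in general, the `E n` contain measurable events with this property. -/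
def AsymptoticallyAlmostSurely {Ω : Type*} [MeasurableSpace Ω] (P : Measure Ω)
    (E : ℕ → Set Ω) : Prop :=
  ∃ A : ℕ → Set Ω, (∀ n, MeasurableSet (A n)) ∧ (∀ n, A n ⊆ E n) ∧
    Tendsto (fun n => P (A n)) atTop (𝓝 1)

/-- Asymptotic optimality of the tensor-product roadmap with connection radius `r n`: for every
`ε > 0`, its lowest-cost path from `S` to `T` exists and costs at most `(1 + ε) c*`, a.a.s. -/
def MultiRobotSystem.IsAsymptoticallyOptimal {R d : ℕ} (M : MultiRobotSystem R d)
    {Ω : Type*} [MeasurableSpace Ω] (P : Measure Ω) (X : (n : ℕ) → Fin R → Fin n → Ω → Config d)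
    (r : ℕ → ℝ) (S T : Composite R d) (cost : (I → Composite R d) → ℝ≥0∞) : Prop :=
  ∀ ε : ℝ, 0 < ε → AsymptoticallyAlmostSurely P (fun n =>
    {ω | ∃ Sig : Path S T,
      M.IsLowestCostPath cost (fun i k => X n i k ω) (r n) Sig ∧
        cost Sig ≤ ENNReal.ofReal (1 + ε) * M.robustOptimum cost S T})

/-- `γ = (1+η) · 2 · (1/d)^(1/d) · (μ(A)/ζ_d)^(1/d)`, where `ζ_d` is the volume of the unit ball. -/
def radiusConstant {d : ℕ} (η : ℝ) (A : Set (Config d)) : ℝ :=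
  (1 + η) * 2 * (1 / (d : ℝ)) ^ (1 / (d : ℝ)) *
    ((volume A).toReal / (volume (Metric.ball (0 : Config d) 1)).toReal) ^ (1 / (d : ℝ))

end

/-!
The proof combines a deterministic comparison of curves with the estimate that the samples are
dense enough around a fixed curve.

A robust trajectory `Σ` whose cost is close to `c*` is first regularized
(`IsRobust.exists_isRegularization`): an inscribed polyline has at most the same length and is
Lipschitz, and a push towards the centre of the cube, proportional to `min τ (1 - τ)`, keeps it away
from the boundary of the cube, where balls would contain too few samples. Clearance is only measured
to obstacles inside the cube, so a robust trajectory may well run along the boundary, and its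
endpoints may lie on it.

Let `ρ = γ (log n / n) ^ (1 / d) / (2 + η)`, and cut the regularized curve `f` at the times `j / K`,
with `K` of order `1 / ρ`, so that consecutive points have distance at most `η ρ`. Samples in
consecutive balls of radius `ρ` then have distance less than `(2 + η) ρ ≤ r n`, and since all robots
are shadowed along the same partition, the resulting chain is a path of the tensor-product roadmap
that stays within `O(ρ)` of the curve, hence is collision-free. The choice of `γ` makes a ball of
radius `ρ` empty with probability at most `n ^ (-1 / d)`
(`IsUniformSampling.measure_miss_ball_le`); there are `O(1 / ρ) = o(n ^ (1 / d))` balls, so with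
probability tending to `1` none of them is empty. The boundedly many balls near the endpoints that
stick out of the cube are still empty with a probability that tends to `0`.

For the cost, the balls of the smaller radius `β ρ` are considered. Each of them is empty with
probability tending to `0`, so by Markov's inequality all but a fraction `β` of them contain a
sample (`IsRegularization.exists_bad_event`). The vertices can therefore be chosen with a total
distance from the curve of order `β ρ K = O(β)`, and the length of the path exceeds that of `Σ` by
an arbitrarily small constant (`IsRegularization.exists_isRoadmapPath_of_samples`).

Finally, a lowest-cost path exists because the costs of roadmap paths are finite sums of elements of
a finite set of nonnegative numbers, and such sums form a well-ordered set
(`exists_isLowestCostPath`). The three costs enter only through `IsTrajectoryCost`.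
-/

/-! ### Polylines -/

/-- The clamping of `t` to `[0, 1]`. -/
noncomputable def ramp (t : ℝ) : ℝ := max 0 (min 1 t)

lemma ramp_monotone : Monotone ramp := fun _ _ h => max_le_max le_rfl (min_le_min le_rfl h)

lemma ramp_nonneg (t : ℝ) : 0 ≤ ramp t := le_max_left _ _

lemma ramp_le_one (t : ℝ) : ramp t ≤ 1 := max_le zero_le_one (min_le_left _ _)

lemma ramp_of_nonpos {t : ℝ} (h : t ≤ 0) : ramp t = 0 :=
  max_eq_left ((min_le_right _ _).trans h)

lemma ramp_of_one_le {t : ℝ} (h : 1 ≤ t) : ramp t = 1 := by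
  simp [ramp, min_eq_left h]

lemma ramp_of_mem {t : ℝ} (h0 : 0 ≤ t) (h1 : t ≤ 1) : ramp t = t := by
  simp [ramp, min_eq_right h1, max_eq_right h0]

lemma abs_ramp_sub_le (a b : ℝ) : |ramp a - ramp b| ≤ |a - b| := by
  refine (abs_max_sub_max_le_max _ _ _ _).trans ?_
  simp only [sub_self, abs_zero]
  refine max_le (abs_nonneg _) ((abs_min_sub_min_le_max _ _ _ _).trans ?_)
  simp

lemma continuous_ramp : Continuous ramp := by unfold ramp; fun_prop

section Polyline

variable {E : Type*} [NormedAddCommGroup E] [NormedSpace ℝ E]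

/-- The polygonal curve that passes through `V k` at time `k / K` for `k = 0, …, K` and is affine
in between. The description as a sum of ramps makes its Lipschitz and variation bounds immediate. -/
noncomputable def polyline (K : ℕ) (V : ℕ → E) (τ : ℝ) : E :=
  V 0 + ∑ k ∈ Finset.range K, ramp (K * τ - k) • (V (k + 1) - V k)

lemma polyline_eq_lineMap {K : ℕ} (V : ℕ → E) {k : ℕ} (hk : k < K) {τ : ℝ}
    (h0 : (k : ℝ) ≤ K * τ) (h1 : (K : ℝ) * τ ≤ k + 1) :
    polyline K V τ = AffineMap.lineMap (V k) (V (k + 1)) ((K : ℝ) * τ - k) := by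
  obtain ⟨m, rfl⟩ : ∃ m, K = k + 1 + m := ⟨K - (k + 1), by omega⟩
  have hsplit : ∑ j ∈ Finset.range (k + 1 + m),
      ramp (((k + 1 + m : ℕ) : ℝ) * τ - j) • (V (j + 1) - V j) =
      (V k - V 0) + (((k + 1 + m : ℕ) : ℝ) * τ - k) • (V (k + 1) - V k) := by
    rw [Finset.sum_range_add, Finset.sum_range_succ]
    have hlow : ∑ j ∈ Finset.range k, ramp (((k + 1 + m : ℕ) : ℝ) * τ - j) • (V (j + 1) - V j) =
        V k - V 0 := by
      rw [← Finset.sum_range_sub]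
      refine Finset.sum_congr rfl fun j hj => ?_
      have hj' : (j : ℝ) + 1 ≤ k := by exact_mod_cast Finset.mem_range.1 hj
      rw [ramp_of_one_le (by linarith), one_smul]
    have hhigh : ∑ j ∈ Finset.range m, ramp (((k + 1 + m : ℕ) : ℝ) * τ - (k + 1 + j : ℕ)) •
        (V (k + 1 + j + 1) - V (k + 1 + j)) = 0 := by
      refine Finset.sum_eq_zero fun j _ => ?_
      have : (0 : ℝ) ≤ j := j.cast_nonneg
      rw [ramp_of_nonpos (by push_cast at h1 ⊢; linarith), zero_smul]
    rw [hlow, hhigh, ramp_of_mem (by linarith) (by linarith), add_zero]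
  rw [polyline, hsplit, AffineMap.lineMap_apply_module']
  abel

lemma polyline_natCast_div {K : ℕ} (V : ℕ → E) (hK : 0 < K) {k : ℕ} (hk : k ≤ K) :
    polyline K V ((k : ℝ) / K) = V k := by
  have hK' : (K : ℝ) ≠ 0 := by positivity
  rcases hk.lt_or_eq with h | rfl
  · rw [polyline_eq_lineMap V h] <;> rw [mul_div_cancel₀ _ hK'] <;> simp
  · obtain ⟨m, rfl⟩ : ∃ m, k = m + 1 := ⟨k - 1, by omega⟩
    rw [polyline_eq_lineMap V (Nat.lt_succ_self m)] <;> rw [mul_div_cancel₀ _ hK'] <;> simp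

lemma polyline_zero {K : ℕ} (V : ℕ → E) (hK : 0 < K) : polyline K V 0 = V 0 := by
  simpa using polyline_natCast_div V hK (Nat.zero_le K)

lemma polyline_one {K : ℕ} (V : ℕ → E) (hK : 0 < K) : polyline K V 1 = V K := by
  have hK' : (K : ℝ) ≠ 0 := by positivity
  simpa [hK'] using polyline_natCast_div V hK le_rfl

lemma exists_polyline_eq_lineMap {K : ℕ} (V : ℕ → E) (hK : 0 < K) {τ : ℝ} (hτ : τ ∈ Icc (0 : ℝ) 1) :
    ∃ k < K, ∃ t ∈ Icc (0 : ℝ) 1, polyline K V τ = AffineMap.lineMap (V k) (V (k + 1)) t := by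
  have hK' : (0 : ℝ) < K := by positivity
  rcases hτ.2.lt_or_eq with h | rfl
  · have h0 : 0 ≤ K * τ := mul_nonneg hK'.le hτ.1
    have hlo := Nat.floor_le h0
    have hhi := (Nat.lt_floor_add_one (K * τ)).le
    have hk : ⌊K * τ⌋₊ < K := (Nat.floor_lt h0).2 (by nlinarith)
    exact ⟨_, hk, _, ⟨by linarith, by linarith⟩, polyline_eq_lineMap V hk hlo hhi⟩
  · refine ⟨K - 1, by omega, 1, by simp, ?_⟩
    rw [polyline_one V hK, AffineMap.lineMap_apply_one, Nat.sub_add_cancel hK]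

lemma continuous_polyline (K : ℕ) (V : ℕ → E) : Continuous (polyline K V) := by
  unfold polyline
  have := continuous_ramp
  fun_prop

lemma norm_polyline_sub_le (K : ℕ) (V : ℕ → E) {a b : ℝ} (hab : a ≤ b) :
    ‖polyline K V b - polyline K V a‖ ≤
      ∑ k ∈ Finset.range K, (ramp (K * b - k) - ramp (K * a - k)) * ‖V (k + 1) - V k‖ := by
  rw [polyline, polyline, add_sub_add_left_eq_sub, ← Finset.sum_sub_distrib]
  refine (norm_sum_le _ _).trans (Finset.sum_le_sum fun k _ => ?_)
  rw [← sub_smul, norm_smul, Real.norm_of_nonneg]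
  exact sub_nonneg.2 (ramp_monotone (by gcongr))

lemma exists_lipschitz_polyline (K : ℕ) (V : ℕ → E) :
    ∃ C : ℝ, 0 ≤ C ∧ ∀ a b : ℝ, ‖polyline K V a - polyline K V b‖ ≤ C * |a - b| := by
  refine ⟨K * ∑ k ∈ Finset.range K, ‖V (k + 1) - V k‖, by positivity, fun a b => ?_⟩
  wlog hab : b ≤ a generalizing a b
  · rw [norm_sub_rev, abs_sub_comm]
    exact this b a (le_of_not_ge hab)
  refine (norm_polyline_sub_le K V hab).trans ?_
  rw [mul_assoc, mul_comm (∑ k ∈ Finset.range K, _), ← mul_assoc, Finset.mul_sum]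
  refine Finset.sum_le_sum fun k _ => mul_le_mul_of_nonneg_right ?_ (norm_nonneg _)
  refine (le_abs_self _).trans ((abs_ramp_sub_le _ _).trans_eq ?_)
  rw [sub_sub_sub_cancel_right, ← mul_sub, abs_mul, Nat.abs_cast]

/-- A polyline is not longer than the sum of the lengths of its edges. -/
lemma sum_norm_polyline_sub_le (K : ℕ) (V : ℕ → E) {u : ℕ → ℝ} (hu : Monotone u) (m : ℕ) :
    ∑ j ∈ Finset.range m, ‖polyline K V (u (j + 1)) - polyline K V (u j)‖ ≤
      ∑ k ∈ Finset.range K, ‖V (k + 1) - V k‖ := by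
  refine (Finset.sum_le_sum fun j _ => norm_polyline_sub_le K V (hu j.le_succ)).trans ?_
  rw [Finset.sum_comm]
  refine Finset.sum_le_sum fun k _ => ?_
  rw [← Finset.sum_mul, Finset.sum_range_sub (fun j => ramp (K * u j - k))]
  refine mul_le_of_le_one_left (norm_nonneg _) ?_
  linarith [ramp_nonneg (K * u 0 - k), ramp_le_one (K * u m - k)]

end Polyline

lemma polyline_apply {R d : ℕ} (K : ℕ) (V : ℕ → Composite R d) (τ : ℝ) (i : Fin R) :
    polyline K V τ i = polyline K (fun k => V k i) τ := by
  simp [polyline]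

/-! ### Arc length and cost functions -/

section ArcLength

lemma eVariationOn_Icc_eq_edist_of_lineMap {E : Type*} [NormedAddCommGroup E] [NormedSpace ℝ E]
    {g : ℝ → E} {v w : E} {a b : ℝ} (hab : a < b)
    (hg : ∀ τ ∈ Icc a b, g τ = AffineMap.lineMap v w ((τ - a) / (b - a))) :
    eVariationOn g (Icc a b) = edist v w := by
  have hba : 0 < b - a := sub_pos.2 hab
  have ha : a ∈ Icc a b := left_mem_Icc.2 hab.le
  have hb : b ∈ Icc a b := right_mem_Icc.2 hab.le
  apply le_antisymm
  · have hmono : MonotoneOn (fun τ : ℝ => (τ - a) / (b - a)) (Icc a b) := fun x _ y _ h => by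
      dsimp only; gcongr
    rw [eVariationOn.eq_of_eqOn (f' := (AffineMap.lineMap v w : ℝ → E) ∘
      fun τ : ℝ => (τ - a) / (b - a)) (fun τ hτ => hg τ hτ)]
    refine (((lipschitzWith_lineMap (𝕜 := ℝ) v w).lipschitzOnWith (s := univ)).comp_eVariationOn_le
      (mapsTo_univ _ _)).trans ?_
    have hvar := hmono.eVariationOn_eq ha hb
    rw [inter_self] at hvar
    rw [hvar, sub_self, zero_div, sub_zero, div_self hba.ne',
      ENNReal.ofReal_one, mul_one, edist_nndist]
  · have h := eVariationOn.edist_le g ha hb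
    rwa [hg a ha, hg b hb, sub_self, zero_div, div_self hba.ne', AffineMap.lineMap_apply_zero,
      AffineMap.lineMap_apply_one] at h

lemma arcLength_eq_eVariationOn {X : Type*} [PseudoEMetricSpace X] (f : I → X) :
    arcLength f = eVariationOn (f ∘ projIcc (0 : ℝ) 1 zero_le_one) (Icc 0 1) := by
  rw [eVariationOn.comp_eq_of_monotoneOn f _ ((monotone_projIcc _).monotoneOn _), arcLength]
  congr 1
  exact (eq_univ_of_forall fun x => ⟨(x : ℝ), x.2, projIcc_val zero_le_one x⟩ :
    projIcc (0 : ℝ) 1 zero_le_one '' Icc 0 1 = univ).symm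

/-- The arc length of a piecewise affine curve is the sum of the lengths of its edges. -/
lemma arcLength_of_piecewise_lineMap {E : Type*} [NormedAddCommGroup E] [NormedSpace ℝ E]
    {f : I → E} {m : ℕ} {u : ℕ → ℝ} {V : ℕ → E} (h0 : u 0 = 0) (h1 : u m = 1)
    (hlt : ∀ k < m, u k < u (k + 1))
    (hf : ∀ k < m, ∀ τ : I, u k ≤ τ → (τ : ℝ) ≤ u (k + 1) →
      f τ = AffineMap.lineMap (V k) (V (k + 1)) (((τ : ℝ) - u k) / (u (k + 1) - u k))) :
    arcLength f = ∑ k ∈ Finset.range m, edist (V k) (V (k + 1)) := by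
  -- The values `u k` with `k > m` are arbitrary, so the partition is frozen after time `1`.
  have hmono : Monotone fun k => u (min k m) := by
    refine monotone_nat_of_le_succ fun k => ?_
    rcases lt_or_ge k m with h | h
    · rw [min_eq_left h.le, min_eq_left (Nat.succ_le_of_lt h)]
      exact (hlt k h).le
    · rw [min_eq_right h, min_eq_right (h.trans k.le_succ)]
  have hsum := eVariationOn.sum' (f ∘ projIcc (0 : ℝ) 1 zero_le_one) hmono (n := m)
  simp only [Nat.zero_min, min_self, h0, h1] at hsum
  rw [arcLength_eq_eVariationOn, ← hsum]
  refine Finset.sum_congr rfl fun k hk => ?_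
  have hk := Finset.mem_range.1 hk
  rw [min_eq_left hk.le, min_eq_left (Nat.succ_le_of_lt hk)]
  refine eVariationOn_Icc_eq_edist_of_lineMap (hlt k hk) fun τ hτ => ?_
  have hle0 : 0 ≤ u k := by
    have := hmono (Nat.zero_le k)
    simpa [min_eq_left hk.le, h0] using this
  have hle1 : u (k + 1) ≤ 1 := by
    have := hmono (Nat.succ_le_of_lt hk)
    simpa [min_eq_left (Nat.succ_le_of_lt hk), h1] using this
  have hmem : τ ∈ Icc (0 : ℝ) 1 := ⟨hle0.trans hτ.1, hτ.2.trans hle1⟩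
  rw [Function.comp_apply, projIcc_of_mem _ hmem]
  exact hf k hk ⟨τ, hmem⟩ hτ.1 hτ.2

end ArcLength

/-- What the three costs have in common: the cost bounds the displacement of every robot, it grows
by at most `R e` if the composite arc length and the arc length of every robot grow by at most `e`,
and it is a sum of such arc lengths. -/
structure IsTrajectoryCost {R d : ℕ} (cost : (I → Composite R d) → ℝ≥0∞) : Prop where
  edist_le : ∀ (f : I → Composite R d) (i : Fin R), edist (f 0 i) (f 1 i) ≤ cost f
  le_add : ∀ (f g : I → Composite R d) (e : ℝ≥0∞), arcLength f ≤ arcLength g + e →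
    (∀ i, arcLength (fun τ => f τ i) ≤ arcLength (fun τ => g τ i) + e) → cost f ≤ cost g + R * e
  mem_closure : ∀ f : I → Composite R d, cost f ∈ AddSubmonoid.closure
    (insert (arcLength f) (range fun i => arcLength (fun τ => f τ i)))

lemma edist_apply_le {R d : ℕ} (V W : Composite R d) (i : Fin R) :
    edist (V i) (W i) ≤ edist V W := by
  rw [edist_dist, edist_dist, dist_eq_norm, dist_eq_norm]
  exact ENNReal.ofReal_le_ofReal (PiLp.norm_apply_le (V - W) i)

section Costs

variable {R d : ℕ}

lemma isTrajectoryCost_sumLengthCost : IsTrajectoryCost (sumLengthCost (R := R) (d := d)) where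
  edist_le f i := (eVariationOn.edist_le (fun τ => f τ i) (mem_univ _) (mem_univ _)).trans
    (Finset.single_le_sum (f := fun i => arcLength (fun τ => f τ i)) (fun _ _ => zero_le)
      (Finset.mem_univ i))
  le_add f g e _ h := by
    refine (Finset.sum_le_sum fun i _ => h i).trans_eq ?_
    simp [Finset.sum_add_distrib, sumLengthCost]
  mem_closure f := AddSubmonoid.sum_mem _ fun i _ =>
    AddSubmonoid.subset_closure (mem_insert_of_mem _ (mem_range_self i))

lemma one_le_natCast_fin (i : Fin R) : (1 : ℝ≥0∞) ≤ R := by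
  exact_mod_cast (Nat.zero_le _).trans_lt i.2

lemma isTrajectoryCost_maxLengthCost : IsTrajectoryCost (maxLengthCost (R := R) (d := d)) where
  edist_le f i := (eVariationOn.edist_le (fun τ => f τ i) (mem_univ _) (mem_univ _)).trans
    (le_iSup (fun i => arcLength (fun τ => f τ i)) i)
  le_add f g e _ h := by
    refine iSup_le fun i => (h i).trans (add_le_add (le_iSup (fun i => arcLength fun τ => g τ i) i)
      (le_mul_of_one_le_left' (one_le_natCast_fin i)))
  mem_closure f := by
    rcases isEmpty_or_nonempty (Fin R) with hR | hR
    · simp only [maxLengthCost, iSup_of_empty]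
      exact AddSubmonoid.zero_mem _
    · obtain ⟨i, hi⟩ := exists_eq_ciSup_of_finite (f := fun i => arcLength fun τ => f τ i)
      exact AddSubmonoid.subset_closure (mem_insert_of_mem _ ⟨i, hi⟩)

lemma isTrajectoryCost_euclideanLengthCost (hR : 1 ≤ R) :
    IsTrajectoryCost (euclideanLengthCost (R := R) (d := d)) where
  edist_le f i := (edist_apply_le _ _ i).trans
    (eVariationOn.edist_le f (mem_univ _) (mem_univ _))
  le_add f g e h _ := h.trans (add_le_add le_rfl (le_mul_of_one_le_left' (by exact_mod_cast hR)))
  mem_closure f := AddSubmonoid.subset_closure (mem_insert _ _)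

end Costs

/-! ### Existence of lowest-cost roadmap paths -/

namespace MultiRobotSystem

variable {R d : ℕ} (M : MultiRobotSystem R d)

lemma finite_tensorVertices (S T : Composite R d) {n : ℕ} (x : Fin R → Fin n → Config d) :
    (tensorVertices S T x).Finite := by
  have h : (Set.univ.pi fun i => prmVertices (S i) (T i) (x i)).Finite :=
    Set.Finite.pi fun i => ((finite_singleton _).insert _).union (finite_range _)
  refine (h.image (WithLp.toLp 2)).subset fun V hV => ⟨WithLp.ofLp V, fun i _ => hV i, rfl⟩

/-- The costs of the roadmap paths are finite sums of elements of a finite set of nonnegative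
numbers; such sums form a well-ordered set, so the lowest cost is attained. -/
lemma exists_isLowestCostPath {cost : (I → Composite R d) → ℝ≥0∞} (hcost : IsTrajectoryCost cost)
    {S T : Composite R d} {n : ℕ} (x : Fin R → Fin n → Config d) (ρ : ℝ) {Sig : Path S T}
    (hSig : M.IsRoadmapPath x ρ Sig) :
    ∃ Sig' : Path S T, M.IsLowestCostPath cost x ρ Sig' ∧ cost Sig' ≤ cost Sig := by
  classical
  set B := tensorVertices S T x with hB
  set F : Set NNReal := ((fun p : Composite R d × Composite R d => nndist p.1 p.2) '' (B ×ˢ B)) ∪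
    ⋃ i : Fin R, (fun p : Composite R d × Composite R d => nndist (p.1 i) (p.2 i)) '' (B ×ˢ B)
  have hBfin : (B ×ˢ B).Finite := (finite_tensorVertices S T x).prod (finite_tensorVertices S T x)
  have hF : F.Finite := (hBfin.image _).union (finite_iUnion fun i => hBfin.image _)
  have hPWO : (AddSubmonoid.closure F : Set NNReal).IsPWO :=
    hF.isPWO.addSubmonoid_closure fun _ _ => zero_le
  have hmem : ∀ Sg : Path S T, M.IsRoadmapPath x ρ Sg →
      ∃ c ∈ AddSubmonoid.closure F, (c : ℝ≥0∞) = cost Sg := by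
    rintro Sg ⟨-, m, V, u, h0, h1, hk⟩
    suffices h : AddSubmonoid.closure (insert (arcLength Sg)
        (range fun i => arcLength (fun τ => Sg τ i))) ≤
        (AddSubmonoid.closure F).map ENNReal.ofNNRealHom.toAddMonoidHom from
      h (hcost.mem_closure Sg)
    have hlt : ∀ k < m, u k < u (k + 1) := fun k h => (hk k h).1
    rw [AddSubmonoid.closure_le]
    rintro _ (rfl | ⟨i, rfl⟩)
    · refine ⟨∑ k ∈ Finset.range m, nndist (V k) (V (k + 1)), AddSubmonoid.sum_mem _ fun k h =>
        AddSubmonoid.subset_closure (Or.inl ?_), ?_⟩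
      · have h' := (hk k (Finset.mem_range.1 h)).2.1
        exact ⟨(V k, V (k + 1)), ⟨h'.1, h'.2.1⟩, rfl⟩
      · rw [arcLength_of_piecewise_lineMap h0 h1 hlt (V := V) fun k h => (hk k h).2.2]
        simp
    · refine ⟨∑ k ∈ Finset.range m, nndist (V k i) (V (k + 1) i), AddSubmonoid.sum_mem _
        fun k h => AddSubmonoid.subset_closure (Or.inr (mem_iUnion.2 ⟨i, ?_⟩)), ?_⟩
      · have h' := (hk k (Finset.mem_range.1 h)).2.1
        exact ⟨(V k, V (k + 1)), ⟨h'.1, h'.2.1⟩, rfl⟩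
      · dsimp only
        rw [arcLength_of_piecewise_lineMap h0 h1 hlt (V := fun k => V k i) fun k h τ ha hb => by
          rw [(hk k h).2.2 τ ha hb]
          simp [AffineMap.lineMap_apply_module']]
        simp
  set C : Set NNReal := {c | ∃ Sg : Path S T, M.IsRoadmapPath x ρ Sg ∧ (c : ℝ≥0∞) = cost Sg}
  have hCW : C.IsWF := by
    refine (hPWO.mono ?_).isWF
    rintro c ⟨Sg, hSg, hc⟩
    obtain ⟨c', hc', h⟩ := hmem Sg hSg
    have : c = c' := by exact_mod_cast hc.trans h.symm
    exact this ▸ hc'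
  obtain ⟨c₀, -, hc₀⟩ := hmem Sig hSig
  have hne : C.Nonempty := ⟨c₀, Sig, hSig, hc₀⟩
  obtain ⟨Sm, hSm, hmin⟩ := hCW.min_mem hne
  refine ⟨Sm, ⟨hSm, fun Sg hSg => ?_⟩, ?_⟩
  · obtain ⟨c, -, hc⟩ := hmem Sg hSg
    rw [← hmin, ← hc]
    exact_mod_cast hCW.min_le hne ⟨Sg, hSg, hc⟩
  · rw [← hmin, ← hc₀]
    exact_mod_cast hCW.min_le hne ⟨Sig, hSig, hc₀⟩

end MultiRobotSystem

/-! ### Cubes and clearance -/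

section Cube

lemma PiLp.norm_le_sum_norm {ι : Type*} [Fintype ι] {β : ι → Type*}
    [∀ i, SeminormedAddCommGroup (β i)] (x : PiLp 2 β) : ‖x‖ ≤ ∑ i, ‖x i‖ := by
  rw [PiLp.norm_eq_of_L2]
  exact (Real.sqrt_le_left (Finset.sum_nonneg fun i _ => norm_nonneg _)).2
    (Finset.sum_sq_le_sq_sum_of_nonneg fun i _ => norm_nonneg _)

lemma lineMap_mem_cube {d : ℕ} {v w : Config d} (hv : v ∈ cube d) (hw : w ∈ cube d) {t : ℝ}
    (ht : t ∈ Icc (0 : ℝ) 1) : AffineMap.lineMap v w t ∈ cube d := fun k => by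
  have h := (convex_Icc (0 : ℝ) 1).lineMap_mem (hv k) (hw k) ht
  simpa [AffineMap.lineMap_apply_module'] using h

lemma lineMap_apply_composite {R d : ℕ} (V W : Composite R d) (t : ℝ) (i : Fin R) :
    (AffineMap.lineMap V W t : Composite R d) i = AffineMap.lineMap (V i) (W i) t := by
  simp [AffineMap.lineMap_apply_module']

lemma lineMap_mem_compositeCube {R d : ℕ} {V W : Composite R d} (hV : V ∈ compositeCube R d)
    (hW : W ∈ compositeCube R d) {t : ℝ} (ht : t ∈ Icc (0 : ℝ) 1) :
    AffineMap.lineMap V W t ∈ compositeCube R d := fun i => by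
  rw [lineMap_apply_composite]
  exact lineMap_mem_cube (hV i) (hW i) ht

/-- The centre of the cube `[0,1]^d`. -/
noncomputable def cubeCenter (d : ℕ) : Config d := WithLp.toLp 2 fun _ => 1 / 2

/-- The centre of the composite cube. -/
noncomputable def compositeCenter (R d : ℕ) : Composite R d := WithLp.toLp 2 fun _ => cubeCenter d

lemma norm_cubeCenter_sub_le {d : ℕ} {q : Config d} (hq : q ∈ cube d) :
    ‖cubeCenter d - q‖ ≤ d := by
  refine (PiLp.norm_le_sum_norm _).trans ?_
  refine (Finset.sum_le_card_nsmul _ _ 1 fun k _ => ?_).trans_eq (by simp)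
  have h := hq k
  simp only [cubeCenter, PiLp.sub_apply, Real.norm_eq_abs]
  exact abs_le.2 ⟨by linarith [h.2], by linarith [h.1]⟩

lemma norm_compositeCenter_sub_le {R d : ℕ} {Q : Composite R d} (hQ : Q ∈ compositeCube R d) :
    ‖compositeCenter R d - Q‖ ≤ R * d := by
  refine (PiLp.norm_le_sum_norm _).trans ?_
  refine (Finset.sum_le_card_nsmul _ _ (d : ℝ) fun i _ => ?_).trans_eq (by simp)
  exact norm_cubeCenter_sub_le (hQ i)

end Cube

namespace MultiRobotSystem

variable {R d : ℕ} (M : MultiRobotSystem R d)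

lemma compositeFree_subset_compositeCube : M.compositeFree ⊆ compositeCube R d :=
  fun _ hQ i => M.free_subset_cube i (hQ.1 i)

/-- The composite configuration `Q` has distance at least `δ` from the obstacle space. -/
def HasClearance (δ : ℝ) (Q : Composite R d) : Prop :=
  Q ∈ compositeCube R d ∧ ∀ X ∈ M.compositeObstacle, δ ≤ ‖Q - X‖

variable {M}

lemma HasClearance.mem_compositeFree {δ : ℝ} {Q Q' : Composite R d} (h : M.HasClearance δ Q)
    (hQ' : Q' ∈ compositeCube R d) (hlt : ‖Q - Q'‖ < δ) : Q' ∈ M.compositeFree := by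
  by_contra hn
  exact (h.2 Q' ⟨hQ', hn⟩).not_gt hlt

lemma HasClearance.of_norm_sub_le {δ e : ℝ} {Q Q' : Composite R d} (h : M.HasClearance δ Q)
    (hQ' : Q' ∈ compositeCube R d) (hle : ‖Q - Q'‖ ≤ e) : M.HasClearance (δ - e) Q' :=
  ⟨hQ', fun X hX => by linarith [h.2 X hX, norm_sub_le_norm_sub_add_norm_sub Q Q' X]⟩

/-- Around a configuration with clearance `δ`, each robot alone may move by less than `δ`. -/
lemma HasClearance.mem_free {δ : ℝ} {Q : Composite R d} (h : M.HasClearance δ Q) {i : Fin R}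
    {q : Config d} (hq : q ∈ cube d) (hlt : ‖Q i - q‖ < δ) : q ∈ M.free i := by
  classical
  set Q' : Composite R d := WithLp.toLp 2 (Function.update (WithLp.ofLp Q) i q) with hQ'
  have hi : Q' i = q := by simp [hQ']
  have hj : ∀ j, j ≠ i → Q' j = Q j := fun j hji => by simp [hQ', hji]
  have hmem : Q' ∈ compositeCube R d := fun j => by
    by_cases hji : j = i
    · subst hji; rwa [hi]
    · rw [hj j hji]; exact h.1 j
  have hnorm : ‖Q - Q'‖ ≤ ‖Q i - q‖ := by
    refine (PiLp.norm_le_sum_norm _).trans_eq ?_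
    rw [Finset.sum_eq_single i]
    · rw [PiLp.sub_apply, hi]
    · intro j _ hji
      rw [PiLp.sub_apply, hj j hji, sub_self, norm_zero]
    · simp
  exact hi ▸ (h.mem_compositeFree hmem (hnorm.trans_lt hlt)).1 i

end MultiRobotSystem

/-! ### Regularization of robust trajectories -/

lemma eVariationOn_le_of_norm_sub_le_polyline {E : Type*} [NormedAddCommGroup E] [NormedSpace ℝ E]
    {N : ℕ} {W : ℕ → E} {g : ℝ → E} {e : ℝ} (he : 0 ≤ e)
    (hg : ∀ a ∈ Icc (0 : ℝ) 1, ∀ b ∈ Icc (0 : ℝ) 1,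
      ‖g a - g b‖ ≤ ‖polyline N W a - polyline N W b‖ + e * |a - b|) :
    eVariationOn g (Icc 0 1) ≤
      ∑ k ∈ Finset.range N, edist (W (k + 1)) (W k) + ENNReal.ofReal e := by
  refine iSup_le ?_
  rintro ⟨n, u, hu, hmem⟩
  dsimp only
  calc ∑ j ∈ Finset.range n, edist (g (u (j + 1))) (g (u j))
      = ENNReal.ofReal (∑ j ∈ Finset.range n, ‖g (u (j + 1)) - g (u j)‖) := by
        rw [ENNReal.ofReal_sum_of_nonneg fun _ _ => norm_nonneg _]
        exact Finset.sum_congr rfl fun j _ => by rw [edist_dist, dist_eq_norm]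
    _ ≤ ENNReal.ofReal (∑ k ∈ Finset.range N, ‖W (k + 1) - W k‖ + e) := by
        refine ENNReal.ofReal_le_ofReal ?_
        refine (Finset.sum_le_sum fun j _ => hg _ (hmem (j + 1)) _ (hmem j)).trans ?_
        rw [Finset.sum_add_distrib, ← Finset.mul_sum]
        refine add_le_add (sum_norm_polyline_sub_le N W hu n) (mul_le_of_le_one_right he ?_)
        rw [Finset.sum_congr rfl fun j _ => abs_of_nonneg (sub_nonneg.2 (hu j.le_succ)),
          Finset.sum_range_sub]
        linarith [(hmem n).2, (hmem 0).1]
    _ = _ := by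
        rw [ENNReal.ofReal_add (Finset.sum_nonneg fun _ _ => norm_nonneg _) he,
          ENNReal.ofReal_sum_of_nonneg fun _ _ => norm_nonneg _]
        simp_rw [edist_dist, dist_eq_norm]

namespace MultiRobotSystem

variable {R d : ℕ}

/-- The curve `f` on `[0, 1]` has the same endpoints as the trajectory `Sig`, is Lipschitz with
constant `Λ`, keeps clearance `δ`, and is at most `ε` longer than `Sig`, for the composite arc
length and for that of every robot. Moreover, it leaves and reaches the boundary of the cube
transversally: at time `τ`, every robot has distance at least `lam * min τ (1 - τ)` from it. -/
structure IsRegularization (M : MultiRobotSystem R d) {S T : Composite R d} (Sig : Path S T)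
    (ε : ℝ) (f : ℝ → Composite R d) (Λ lam δ : ℝ) : Prop where
  lipschitz_pos : 0 < Λ
  lam_pos : 0 < lam
  clearance_pos : 0 < δ
  map_zero : f 0 = S
  map_one : f 1 = T
  lipschitz : ∀ a ∈ Icc (0 : ℝ) 1, ∀ b ∈ Icc (0 : ℝ) 1, ‖f a - f b‖ ≤ Λ * |a - b|
  clearance : ∀ τ ∈ Icc (0 : ℝ) 1, M.HasClearance δ (f τ)
  mem_Icc : ∀ τ ∈ Icc (0 : ℝ) 1, ∀ i k,
    f τ i k ∈ Icc (lam * min τ (1 - τ)) (1 - lam * min τ (1 - τ))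
  variation_le : eVariationOn f (Icc 0 1) ≤ arcLength Sig + ENNReal.ofReal ε
  variation_apply_le : ∀ i, eVariationOn (fun τ => f τ i) (Icc 0 1) ≤
    arcLength (fun τ => Sig τ i) + ENNReal.ofReal ε

lemma abs_min_one_sub_sub_le (a b : ℝ) : |min a (1 - a) - min b (1 - b)| ≤ |a - b| := by
  refine (abs_min_sub_min_le_max _ _ _ _).trans (max_le le_rfl ?_)
  rw [sub_sub_sub_cancel_left, abs_sub_comm]

/-- A robust trajectory is regularized by an inscribed polyline, pushed towards the centre of the
cube by a small amount that vanishes at the endpoints. -/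
lemma IsRobust.exists_isRegularization {M : MultiRobotSystem R d} {S T : Composite R d}
    {Sig : Path S T} (hSig : M.IsRobust Sig) {ε : ℝ} (hε : 0 < ε) :
    ∃ f Λ lam δ, M.IsRegularization Sig ε f Λ lam δ := by
  obtain ⟨hfree, δ₀, hδ₀, hclear⟩ := hSig
  have hSclear : ∀ τ, M.HasClearance δ₀ (Sig τ) := fun τ =>
    ⟨M.compositeFree_subset_compositeCube (hfree τ), hclear τ⟩
  obtain ⟨ν, hν, huc⟩ := Metric.uniformContinuous_iff.1
    (CompactSpace.uniformContinuous_of_continuous Sig.continuous) (δ₀ / 4) (by positivity)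
  obtain ⟨N₀, hN₀⟩ := exists_nat_one_div_lt hν
  set N := N₀ + 1 with hN
  have hNpos : 0 < N := N₀.succ_pos
  have hNpos' : (0 : ℝ) < N := by positivity
  set t : ℕ → I := fun k => projIcc (0 : ℝ) 1 zero_le_one ((k : ℝ) / N) with ht
  have htmono : Monotone t := fun a b hab => monotone_projIcc _ (by gcongr)
  set V : ℕ → Composite R d := fun k => Sig (t k) with hV
  have hVcube : ∀ k, V k ∈ compositeCube R d := fun k => (hSclear (t k)).1
  have ht1 : t N = 1 := by
    simp only [ht, div_self hNpos'.ne']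
    exact projIcc_right zero_le_one
  have ht0 : t 0 = 0 := by
    simp only [ht, Nat.cast_zero, zero_div]
    exact projIcc_left zero_le_one
  have hVdist : ∀ k, ‖V k - V (k + 1)‖ ≤ δ₀ / 4 := fun k => by
    rw [← dist_eq_norm]
    refine (huc ?_).le
    rw [Subtype.dist_eq, Real.dist_eq]
    refine (abs_projIcc_sub_projIcc zero_le_one).trans_lt ?_
    rw [← sub_div, abs_div, Nat.abs_cast]
    push_cast [hN]
    rw [show (k : ℝ) - (k + 1) = -1 by ring, abs_neg, abs_one]
    exact hN₀
  set p := polyline N V with hp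
  set c := compositeCenter R d with hc
  set D : ℝ := R * d with hD
  have hD0 : 0 ≤ D := by positivity
  have hpcube : ∀ τ ∈ Icc (0 : ℝ) 1, p τ ∈ compositeCube R d := fun τ hτ => by
    obtain ⟨k, -, s, hs, h⟩ := exists_polyline_eq_lineMap V hNpos hτ
    rw [hp, h]
    exact lineMap_mem_compositeCube (hVcube k) (hVcube _) hs
  have hpclear : ∀ τ ∈ Icc (0 : ℝ) 1, M.HasClearance (δ₀ - δ₀ / 4) (p τ) := fun τ hτ => by
    obtain ⟨k, -, s, hs, h⟩ := exists_polyline_eq_lineMap V hNpos hτ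
    refine (hSclear (t k)).of_norm_sub_le (hpcube τ hτ) ?_
    rw [hp, h, ← dist_eq_norm, dist_left_lineMap, Real.norm_of_nonneg hs.1, dist_eq_norm]
    exact (mul_le_of_le_one_left (norm_nonneg _) hs.2).trans (hVdist k)
  obtain ⟨C, hC0, hC⟩ := exists_lipschitz_polyline N V
  obtain ⟨lam, hlam, hlam1, hlamδ, hlamε⟩ : ∃ lam : ℝ, 0 < lam ∧ lam ≤ 1 / 2 ∧
      2 * lam * D ≤ δ₀ / 4 ∧ 2 * lam * D ≤ ε := by
    have hpos : 0 < min (δ₀ / 4) ε / (2 * (D + 1)) := by positivity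
    refine ⟨min (1 / 2) (min (δ₀ / 4) ε / (2 * (D + 1))), by positivity, min_le_left _ _, ?_⟩
    rw [← le_min_iff]
    calc 2 * min (1 / 2) (min (δ₀ / 4) ε / (2 * (D + 1))) * D
        ≤ 2 * (min (δ₀ / 4) ε / (2 * (D + 1))) * (D + 1) := by
          gcongr
          · exact min_le_right _ _
          · linarith
      _ = min (δ₀ / 4) ε := by field_simp
  set h : ℝ → ℝ := fun τ => 2 * lam * min τ (1 - τ) with hh
  have hh0 : ∀ τ ∈ Icc (0 : ℝ) 1, 0 ≤ h τ := fun τ hτ =>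
    mul_nonneg (by positivity) (le_min hτ.1 (by linarith [hτ.2]))
  have hmin1 : ∀ τ ∈ Icc (0 : ℝ) 1, min τ (1 - τ) ≤ 1 := fun τ hτ => (min_le_left _ _).trans hτ.2
  have hh2 : ∀ τ ∈ Icc (0 : ℝ) 1, h τ ≤ 2 * lam := fun τ hτ =>
    mul_le_of_le_one_right (by positivity) (hmin1 τ hτ)
  have hh1 : ∀ τ ∈ Icc (0 : ℝ) 1, h τ ≤ 1 := fun τ hτ => (hh2 τ hτ).trans (by linarith)
  have hhlip : ∀ a b, |h a - h b| ≤ 2 * lam * |a - b| := fun a b => by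
    simp only [hh]
    rw [← mul_sub, abs_mul, abs_of_pos (by positivity : 0 < 2 * lam)]
    exact mul_le_mul_of_nonneg_left (abs_min_one_sub_sub_le a b) (by positivity)
  set f : ℝ → Composite R d := fun τ => AffineMap.lineMap (p τ) c (h τ) with hf
  have hsub : ∀ a b, f a - f b = (1 - h a) • (p a - p b) + (h a - h b) • (c - p b) := fun a b => by
    simp only [hf, AffineMap.lineMap_apply_module]
    module
  have hfi : ∀ τ i k, f τ i k = (1 - h τ) * p τ i k + h τ * (1 / 2) := fun τ i k => by
    simp [hf, AffineMap.lineMap_apply_module, hc, compositeCenter, cubeCenter]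
  have hccube : c ∈ compositeCube R d := fun i k => by
    simp only [hc, compositeCenter, cubeCenter]
    constructor <;> norm_num
  have hcp : ∀ τ ∈ Icc (0 : ℝ) 1, ‖c - p τ‖ ≤ D := fun τ hτ =>
    norm_compositeCenter_sub_le (hpcube τ hτ)
  have hbound : ∀ {E : Type} [NormedAddCommGroup E] [NormedSpace ℝ E] (x y : E) (a b : ℝ),
      a ∈ Icc (0 : ℝ) 1 → ‖y‖ ≤ D →
      ‖(1 - h a) • x + (h a - h b) • y‖ ≤ ‖x‖ + 2 * lam * D * |a - b| := by
    intro E _ _ x y a b ha hy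
    refine (norm_add_le _ _).trans (add_le_add ?_ ?_)
    · rw [norm_smul, Real.norm_of_nonneg (by linarith [hh1 a ha])]
      exact mul_le_of_le_one_left (norm_nonneg _) (by linarith [hh0 a ha])
    · rw [norm_smul, Real.norm_eq_abs]
      calc |h a - h b| * ‖y‖ ≤ (2 * lam * |a - b|) * D := by gcongr; exact hhlip a b
        _ = _ := by ring
  have hfp : ∀ a ∈ Icc (0 : ℝ) 1, ∀ b ∈ Icc (0 : ℝ) 1,
      ‖f a - f b‖ ≤ ‖p a - p b‖ + 2 * lam * D * |a - b| := fun a ha b hb => by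
    rw [hsub]
    exact hbound _ _ a b ha (hcp b hb)
  have hfpi : ∀ i, ∀ a ∈ Icc (0 : ℝ) 1, ∀ b ∈ Icc (0 : ℝ) 1,
      ‖f a i - f b i‖ ≤ ‖p a i - p b i‖ + 2 * lam * D * |a - b| := fun i a ha b hb => by
    have := congrArg (fun Q : Composite R d => Q i) (hsub a b)
    simp only [PiLp.add_apply, PiLp.smul_apply] at this
    rw [← PiLp.sub_apply, this]
    exact hbound _ _ a b ha ((PiLp.norm_apply_le _ i).trans (hcp b hb))
  have he0 : 0 ≤ 2 * lam * D := by positivity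
  refine ⟨f, C + 2 * lam * D + 1, lam, δ₀ - δ₀ / 4 - δ₀ / 4, ?_⟩
  refine ⟨by positivity, hlam, by linarith, ?_, ?_, ?_, ?_, ?_, ?_, ?_⟩
  · have hp0 : p 0 = S := by
      rw [hp, polyline_zero V hNpos]
      simp only [hV, ht0, Sig.source]
    simp [hf, hh, hp0]
  · have hp1 : p 1 = T := by
      rw [hp, polyline_one V hNpos]
      simp only [hV, ht1, Sig.target]
    simp [hf, hh, hp1]
  · intro a ha b hb
    calc ‖f a - f b‖ ≤ C * |a - b| + 2 * lam * D * |a - b| :=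
          (hfp a ha b hb).trans (add_le_add (hC a b) le_rfl)
      _ ≤ (C + 2 * lam * D + 1) * |a - b| := by nlinarith [abs_nonneg (a - b)]
  · intro τ hτ
    refine (hpclear τ hτ).of_norm_sub_le
      (lineMap_mem_compositeCube (hpcube τ hτ) hccube ⟨hh0 τ hτ, hh1 τ hτ⟩) ?_
    rw [← dist_eq_norm, dist_left_lineMap, Real.norm_of_nonneg (hh0 τ hτ), dist_comm,
      dist_eq_norm]
    refine le_trans ?_ hlamδ
    exact mul_le_mul (hh2 τ hτ) (hcp τ hτ) (norm_nonneg _) (by positivity)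
  · intro τ hτ i k
    have h1 := hh1 τ hτ
    have hq := hpcube τ hτ i k
    have e : lam * min τ (1 - τ) = h τ / 2 := by simp only [hh]; ring
    rw [hfi, e]
    constructor <;> nlinarith [hq.1, hq.2]
  · refine (eVariationOn_le_of_norm_sub_le_polyline he0 hfp).trans (add_le_add ?_
      (ENNReal.ofReal_le_ofReal hlamε))
    exact eVariationOn.sum_le htmono fun _ => mem_univ _
  · intro i
    have := eVariationOn_le_of_norm_sub_le_polyline (N := N) (W := fun k => V k i)
      (g := fun τ => f τ i) he0 (fun a ha b hb => by
        simpa only [hp, polyline_apply] using hfpi i a ha b hb)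
    refine this.trans (add_le_add ?_ (ENNReal.ofReal_le_ofReal hlamε))
    exact eVariationOn.sum_le (f := fun τ => Sig τ i) htmono fun _ => mem_univ _

end MultiRobotSystem

/-! ### Roadmap paths that follow a curve -/

lemma sum_edist_le_sum_edist_add {E : Type*} [SeminormedAddCommGroup E] (W g : ℕ → E) (K : ℕ) :
    ∑ k ∈ Finset.range K, edist (W k) (W (k + 1)) ≤
      ∑ k ∈ Finset.range K, edist (g (k + 1)) (g k) +
        ENNReal.ofReal (2 * ∑ j ∈ Finset.range (K + 1), ‖W j - g j‖) := by
  have hnn : ∀ s : Finset ℕ, 0 ≤ ∑ j ∈ s, ‖W j - g j‖ := fun s =>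
    Finset.sum_nonneg fun _ _ => norm_nonneg _
  have hconv : ∑ j ∈ Finset.range (K + 1), edist (W j) (g j) =
      ENNReal.ofReal (∑ j ∈ Finset.range (K + 1), ‖W j - g j‖) := by
    rw [ENNReal.ofReal_sum_of_nonneg fun _ _ => norm_nonneg _]
    exact Finset.sum_congr rfl fun j _ => by rw [edist_dist, dist_eq_norm]
  rw [two_mul, ENNReal.ofReal_add (hnn _) (hnn _), ← hconv]
  calc ∑ k ∈ Finset.range K, edist (W k) (W (k + 1))
      ≤ ∑ k ∈ Finset.range K, (edist (g (k + 1)) (g k) +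
          (edist (W k) (g k) + edist (W (k + 1)) (g (k + 1)))) := by
        refine Finset.sum_le_sum fun k _ => ?_
        refine (edist_triangle4 (W k) (g k) (g (k + 1)) (W (k + 1))).trans_eq ?_
        rw [edist_comm (g k), edist_comm (g (k + 1)) (W (k + 1))]
        ring
    _ ≤ _ := by
        rw [Finset.sum_add_distrib, Finset.sum_add_distrib]
        refine add_le_add le_rfl (add_le_add ?_ ?_)
        · rw [Finset.sum_range_succ]
          exact le_self_add
        · rw [Finset.sum_range_succ']
          exact le_self_add

namespace MultiRobotSystem

variable {R d : ℕ} {M : MultiRobotSystem R d} {S T : Composite R d}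

/-- Vertices that shadow the curve `f` at the times `j / K` closely enough form a collision-free
path over the tensor-product roadmap, and the excess of its length over that of the shadowed
trajectory is controlled by the distances of the vertices from the curve. -/
lemma IsRegularization.exists_isRoadmapPath_of_vertices {Sig : Path S T} {ε : ℝ}
    {f : ℝ → Composite R d} {Λ lam δ : ℝ} (h : M.IsRegularization Sig ε f Λ lam δ) (hε : 0 ≤ ε)
    {n : ℕ} (x : Fin R → Fin n → Config d) {K : ℕ} (hK : 0 < K) {ρ η r : ℝ} (hη : 0 ≤ η)
    (hρ : 0 < ρ) (hstep : Λ / K ≤ η * ρ) (hr : (2 + η) * ρ ≤ r)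
    (hδ : R * ((1 + η) * ρ) < δ) {V : ℕ → Composite R d} (hV0 : V 0 = S) (hVK : V K = T)
    (hVmem : ∀ j ≤ K, V j ∈ tensorVertices S T x) (hVcube : ∀ j ≤ K, V j ∈ compositeCube R d)
    (hclose : ∀ j ≤ K, ∀ i, ‖V j i - f (j / K) i‖ < ρ) {e : ℝ}
    (he : 2 * ∑ j ∈ Finset.range (K + 1), ∑ i, ‖V j i - f (j / K) i‖ ≤ e) :
    ∃ Sg : Path S T, M.IsRoadmapPath x r Sg ∧
      arcLength Sg ≤ arcLength Sig + ENNReal.ofReal (ε + e) ∧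
      ∀ i, arcLength (fun τ => Sg τ i) ≤ arcLength (fun τ => Sig τ i) + ENNReal.ofReal (ε + e) := by
  have hK' : (0 : ℝ) < K := by positivity
  have hmemI : ∀ j ≤ K, (j : ℝ) / K ∈ Icc (0 : ℝ) 1 := fun j hj =>
    ⟨by positivity, (div_le_one hK').2 (by exact_mod_cast hj)⟩
  have he0 : 0 ≤ e := le_trans (by positivity) he
  -- consecutive points of the curve
  have hfstep : ∀ k < K, ∀ i, ‖f ((k : ℕ) / K) i - f ((k + 1 : ℕ) / K) i‖ ≤ η * ρ := by
    intro k hk i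
    rw [← PiLp.sub_apply]
    refine (PiLp.norm_apply_le _ i).trans ((h.lipschitz _ (hmemI k hk.le) _
      (hmemI (k + 1) hk)).trans (le_trans (le_of_eq ?_) hstep))
    rw [← sub_div, abs_div, Nat.abs_cast]
    push_cast
    rw [show (k : ℝ) - (k + 1) = -1 by ring, abs_neg, abs_one, mul_one_div]
  -- a robot moving from `V k` to `V (k + 1)` stays close to the curve
  have hnear : ∀ k < K, ∀ t ∈ Icc (0 : ℝ) 1, ∀ i,
      ‖f (k / K) i - AffineMap.lineMap (V k i) (V (k + 1) i) t‖ ≤ (1 + η) * ρ := by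
    intro k hk t ht i
    have h1 : V k i ∈ Metric.closedBall (f (k / K) i) ((1 + η) * ρ) := by
      rw [mem_closedBall_iff_norm]
      nlinarith [hclose k hk.le i, mul_nonneg hη hρ.le]
    have h2 : V (k + 1) i ∈ Metric.closedBall (f (k / K) i) ((1 + η) * ρ) := by
      rw [mem_closedBall_iff_norm, norm_sub_rev]
      refine (norm_sub_le_norm_sub_add_norm_sub _ (f ((k + 1 : ℕ) / K) i) _).trans ?_
      have := hclose (k + 1) hk i
      rw [norm_sub_rev] at this
      linarith [hfstep k hk i]
    have := (convex_closedBall (f (k / K) i) ((1 + η) * ρ)).lineMap_mem h1 h2 ht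
    rwa [mem_closedBall_iff_norm, norm_sub_rev] at this
  have hfree : ∀ k < K, ∀ t ∈ Icc (0 : ℝ) 1,
      (AffineMap.lineMap (V k) (V (k + 1)) t : Composite R d) ∈ M.compositeFree := by
    intro k hk t ht
    refine (h.clearance _ (hmemI k hk.le)).mem_compositeFree
      (lineMap_mem_compositeCube (hVcube k hk.le) (hVcube (k + 1) hk) ht) (lt_of_le_of_lt ?_ hδ)
    refine (PiLp.norm_le_sum_norm _).trans ?_
    refine (Finset.sum_le_card_nsmul _ _ ((1 + η) * ρ) fun i _ => ?_).trans_eq (by simp)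
    rw [PiLp.sub_apply, lineMap_apply_composite]
    exact hnear k hk t ht i
  have hedge : ∀ k < K, M.tensorEdge S T x r (V k) (V (k + 1)) := by
    intro k hk
    refine ⟨hVmem k hk.le, hVmem (k + 1) hk, fun i => ?_⟩
    by_cases heq : V k i = V (k + 1) i
    · exact Or.inl heq
    refine Or.inr ⟨hVmem k hk.le i, hVmem (k + 1) hk i, heq, ?_, ?_⟩
    · have h1 := hclose k hk.le i
      have h2 := hclose (k + 1) hk i
      have h3 := hfstep k hk i
      rw [← dist_eq_norm] at h1 h2 h3
      rw [dist_comm] at h2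
      linarith [dist_triangle4 (V k i) (f (k / K) i) (f ((k + 1 : ℕ) / K) i) (V (k + 1) i)]
    · rw [segment_eq_image_lineMap]
      rintro _ ⟨t, ht, rfl⟩
      rw [← lineMap_apply_composite]
      exact (hfree k hk t ht).1 i
  set Sg : Path S T :=
    { toFun := fun τ => polyline K V τ
      continuous_toFun := (continuous_polyline K V).comp continuous_subtype_val
      source' := by simpa [hV0] using polyline_zero V hK
      target' := by simpa [hVK] using polyline_one V hK } with hSg
  have hSgapp : ∀ τ : I, Sg τ = polyline K V τ := fun τ => rfl
  have hpiece : ∀ k < K, ∀ τ : I, ((k : ℕ) : ℝ) / K ≤ τ → (τ : ℝ) ≤ ((k + 1 : ℕ) : ℝ) / K →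
      Sg τ = AffineMap.lineMap (V k) (V (k + 1))
        (((τ : ℝ) - (k : ℕ) / K) / (((k + 1 : ℕ) : ℝ) / K - (k : ℕ) / K)) := by
    intro k hk τ h0 h1
    rw [div_le_iff₀' hK'] at h0
    rw [le_div_iff₀' hK'] at h1
    push_cast at h1
    rw [hSgapp, polyline_eq_lineMap V hk h0 h1]
    congr 1
    push_cast
    field_simp
    ring
  have hu0 : ((0 : ℕ) : ℝ) / K = 0 := by simp
  have hu1 : (K : ℝ) / K = 1 := div_self hK'.ne'
  have hult : ∀ k < K, ((k : ℕ) : ℝ) / K < ((k + 1 : ℕ) : ℝ) / K := fun k _ => by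
    gcongr
    exact Nat.lt_succ_self k
  have hmonoI : MonotoneOn (fun j : ℕ => (j : ℝ) / K) (Iic K) := fun a _ b _ hab => by
    dsimp only
    gcongr
  refine ⟨Sg, ⟨fun τ => ?_, K, V, fun k => (k : ℝ) / K, hu0, hu1, fun k hk =>
    ⟨hult k hk, hedge k hk, hpiece k hk⟩⟩, ?_, fun i => ?_⟩
  · obtain ⟨k, hk, t, ht, heq⟩ := exists_polyline_eq_lineMap V hK τ.2
    rw [hSgapp, heq]
    exact hfree k hk t ht
  · rw [arcLength_of_piecewise_lineMap hu0 hu1 hult hpiece, ENNReal.ofReal_add hε he0, ← add_assoc]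
    refine (sum_edist_le_sum_edist_add V (fun j => f (j / K)) K).trans (add_le_add ?_ ?_)
    · exact (eVariationOn.sum_le_of_monotoneOn_Iic hmonoI fun j hj => hmemI j hj).trans
        h.variation_le
    · refine ENNReal.ofReal_le_ofReal (le_trans ?_ he)
      gcongr with j
      exact PiLp.norm_le_sum_norm _
  · rw [arcLength_of_piecewise_lineMap (V := fun k => V k i) hu0 hu1 hult fun k hk τ h0 h1 => by
      rw [hpiece k hk τ h0 h1, lineMap_apply_composite], ENNReal.ofReal_add hε he0, ← add_assoc]
    refine (sum_edist_le_sum_edist_add (fun k => V k i) (fun j => f (j / K) i) K).trans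
      (add_le_add ?_ ?_)
    · exact (eVariationOn.sum_le_of_monotoneOn_Iic (f := fun τ => f τ i) hmonoI
        fun j hj => hmemI j hj).trans (h.variation_apply_le i)
    · refine ENNReal.ofReal_le_ofReal (le_trans ?_ he)
      gcongr with j
      exact Finset.single_le_sum (f := fun i => ‖V j i - f (j / K) i‖)
        (fun _ _ => norm_nonneg _) (Finset.mem_univ i)

open Classical in
/-- If each ball of radius `ρ` about a point `f (j / K) i` contains a sample of robot `i` and at
most `m` of the concentric balls of radius `β ρ` contain none, then some roadmap path is
almost as short as the shadowed trajectory. -/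
lemma IsRegularization.exists_isRoadmapPath_of_samples {Sig : Path S T} {ε : ℝ}
    {f : ℝ → Composite R d} {Λ lam δ : ℝ} (h : M.IsRegularization Sig ε f Λ lam δ) (hε : 0 ≤ ε)
    {n : ℕ} (x : Fin R → Fin n → Config d) {K : ℕ} (hK : 0 < K) {ρ η r β m : ℝ} (hη : 0 ≤ η)
    (hρ : 0 < ρ) (hstep : Λ / K ≤ η * ρ) (hr : (2 + η) * ρ ≤ r)
    (hδ : R * ((1 + η) * ρ) < δ) (hβ : 0 ≤ β)
    (hbig : ∀ j ≤ K, ∀ i, ∃ k, x i k ∈ Metric.ball (f (j / K) i) ρ ∩ cube d)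
    (hsmall : ((((Finset.range (K + 1)) ×ˢ (Finset.univ : Finset (Fin R))).filter
      fun p => ∀ k, x p.2 k ∉ Metric.ball (f (p.1 / K) p.2) (β * ρ) ∩ cube d).card : ℝ) ≤ m) :
    ∃ Sg : Path S T, M.IsRoadmapPath x r Sg ∧
      arcLength Sg ≤ arcLength Sig + ENNReal.ofReal (ε + 2 * ρ * (β * ((K + 1) * R) + m)) ∧
      ∀ i, arcLength (fun τ => Sg τ i) ≤ arcLength (fun τ => Sig τ i) +
        ENNReal.ofReal (ε + 2 * ρ * (β * ((K + 1) * R) + m)) := by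
  have hK' : (0 : ℝ) < K := by positivity
  set bad : ℕ → Fin R → Prop := fun j i =>
    ∀ k, x i k ∉ Metric.ball (f (j / K) i) (β * ρ) ∩ cube d with hbad
  have hf0 : f ((0 : ℕ) / K) = S := by simp [h.map_zero]
  have hfK : f ((K : ℕ) / K) = T := by rw [div_self hK'.ne', h.map_one]
  have hex : ∀ j i, ∃ v : Config d, j ≤ K →
      (v ∈ prmVertices (S i) (T i) (x i) ∧ v ∈ cube d ∧ ‖v - f (j / K) i‖ < ρ ∧
        ‖v - f (j / K) i‖ ≤ β * ρ + (if bad j i then ρ else 0) ∧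
        (j = 0 → v = S i) ∧ (j = K → v = T i)) := by
    intro j i
    by_cases hj : j ≤ K
    swap
    · exact ⟨0, fun h' => absurd h' hj⟩
    have hif : 0 ≤ β * ρ + (if bad j i then ρ else 0) := by
      have : 0 ≤ β * ρ := by positivity
      split_ifs <;> linarith
    by_cases h0 : j = 0
    · subst h0
      have hz : ‖S i - f ((0 : ℕ) / K) i‖ = 0 := by rw [hf0, sub_self, norm_zero]
      refine ⟨S i, fun _ => ⟨Or.inl (Or.inl rfl), ?_, ?_, ?_, fun _ => rfl, fun h' =>
        absurd h'.symm hK.ne'⟩⟩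
      · rw [← h.map_zero]
        exact (h.clearance 0 (by simp)).1 i
      · exact hz.trans_lt hρ
      · exact hz.trans_le hif
    by_cases h1 : j = K
    · subst h1
      have hz : ‖T i - f ((j : ℕ) / j) i‖ = 0 := by rw [hfK, sub_self, norm_zero]
      refine ⟨T i, fun _ => ⟨Or.inl (Or.inr rfl), ?_, ?_, ?_, fun h' => absurd h' h0, fun _ => rfl⟩⟩
      · rw [← h.map_one]
        exact (h.clearance 1 (by simp)).1 i
      · exact hz.trans_lt hρ
      · exact hz.trans_le hif
    obtain ⟨k, hk, hkcube⟩ := hbig j hj i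
    by_cases hb : bad j i
    · refine ⟨x i k, fun _ => ⟨Or.inr (mem_range_self k), hkcube, ?_, ?_, fun h' => absurd h' h0,
        fun h' => absurd h' h1⟩⟩
      · exact mem_ball_iff_norm.1 hk
      · rw [if_pos hb]
        have : 0 ≤ β * ρ := by positivity
        linarith [mem_ball_iff_norm.1 hk]
    · obtain ⟨k', hk', hk'cube⟩ := _root_.not_forall_not.1 hb
      have hk'n := mem_ball_iff_norm.1 hk'
      -- the closer of the two samples lies in both balls
      rcases le_total ‖x i k' - f (j / K) i‖ ‖x i k - f (j / K) i‖ with hle | hle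
      · exact ⟨x i k', fun _ => ⟨Or.inr (mem_range_self k'), hk'cube,
          hle.trans_lt (mem_ball_iff_norm.1 hk), by rw [if_neg hb]; linarith,
          fun h' => absurd h' h0, fun h' => absurd h' h1⟩⟩
      · exact ⟨x i k, fun _ => ⟨Or.inr (mem_range_self k), hkcube,
          mem_ball_iff_norm.1 hk, by rw [if_neg hb]; linarith,
          fun h' => absurd h' h0, fun h' => absurd h' h1⟩⟩
  choose v hv using hex
  refine h.exists_isRoadmapPath_of_vertices hε x hK hη hρ hstep hr hδ
    (V := fun j => WithLp.toLp 2 (v j)) ?_ ?_ (fun j hj i => (hv j i hj).1)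
    (fun j hj i => (hv j i hj).2.1) (fun j hj i => (hv j i hj).2.2.1) ?_
  · ext1 i
    exact (hv 0 i hK.le).2.2.2.2.1 rfl
  · ext1 i
    exact (hv K i le_rfl).2.2.2.2.2 rfl
  · calc 2 * ∑ j ∈ Finset.range (K + 1), ∑ i, ‖v j i - f (j / K) i‖
        ≤ 2 * ∑ j ∈ Finset.range (K + 1), ∑ i : Fin R,
            (β * ρ + (if bad j i then ρ else 0)) := by
          gcongr with j hj i
          exact (hv j i (Nat.lt_succ_iff.1 (Finset.mem_range.1 hj))).2.2.2.1
      _ = 2 * ((K + 1) * R * (β * ρ) + ((((Finset.range (K + 1)) ×ˢ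
            (Finset.univ : Finset (Fin R))).filter fun p => bad p.1 p.2).card : ℝ) * ρ) := by
          rw [← Finset.sum_product' (f := fun j i => β * ρ + (if bad j i then ρ else 0)),
            Finset.sum_add_distrib, ← Finset.sum_filter]
          simp
      _ ≤ 2 * ((K + 1) * R * (β * ρ) + m * ρ) := by gcongr
      _ = 2 * ρ * (β * ((K + 1) * R) + m) := by ring

end MultiRobotSystem

/-! ### Volumes and the probability of missing a ball -/

section Volume

variable {d : ℕ}

lemma volume_ball_config (y : Config d) {s : ℝ} (hs : 0 < s) :
    volume (Metric.ball y s) = ENNReal.ofReal (s ^ d) * volume (Metric.ball (0 : Config d) 1) := by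
  rw [Measure.addHaar_ball_of_pos _ _ hs, finrank_euclideanSpace_fin]

lemma toReal_volume_ball_config (y : Config d) {s : ℝ} (hs : 0 < s) :
    (volume (Metric.ball y s)).toReal =
      s ^ d * (volume (Metric.ball (0 : Config d) 1)).toReal := by
  rw [volume_ball_config y hs, ENNReal.toReal_mul, ENNReal.toReal_ofReal (by positivity)]

lemma toReal_volume_unitBall_pos : 0 < (volume (Metric.ball (0 : Config d) 1)).toReal :=
  ENNReal.toReal_pos (Metric.measure_ball_pos _ _ one_pos).ne' measure_ball_lt_top.ne

lemma cube_subset_closedBall : cube d ⊆ Metric.closedBall (cubeCenter d) d := fun q hq => by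
  rw [mem_closedBall_iff_norm, norm_sub_rev]
  exact norm_cubeCenter_sub_le hq

lemma measurableSet_cube : MeasurableSet (cube d) := by
  simp only [cube, ofPred_forall]
  exact MeasurableSet.iInter fun k => measurableSet_Icc.preimage (by fun_prop)

lemma ball_subset_cube {x : Config d} {ρ : ℝ} (h : ∀ k, x k ∈ Icc ρ (1 - ρ)) :
    Metric.ball x ρ ⊆ cube d := fun q hq k => by
  have h1 := (PiLp.norm_apply_le (q - x) k).trans (mem_ball_iff_norm.1 hq).le
  rw [PiLp.sub_apply, Real.norm_eq_abs, abs_le] at h1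
  constructor
  · linarith [h1.1, (h k).1]
  · linarith [h1.2, (h k).2]

/-- Every ball centred in the cube contains, within the cube, a ball of proportional radius;
its centre is found by moving towards the centre of the cube. -/
lemma exists_ball_subset_ball_inter_cube {x : Config d} (hx : x ∈ cube d) {s : ℝ} (hs : 0 < s)
    (hs1 : s ≤ 1) : ∃ y : Config d,
      Metric.ball y (1 / (2 * (d + 1)) * s) ⊆ Metric.ball x s ∩ cube d := by
  set t : ℝ := s / (d + 1) with ht
  have hd : (0 : ℝ) ≤ d := d.cast_nonneg
  have ht0 : 0 < t := by positivity
  have hts : t * (d + 1) = s := by rw [ht]; field_simp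
  have ht1 : t ≤ 1 := by nlinarith
  have hrad : 1 / (2 * ((d : ℝ) + 1)) * s = t / 2 := by rw [ht]; field_simp
  rw [hrad]
  refine ⟨AffineMap.lineMap x (cubeCenter d) t, subset_inter ?_ (ball_subset_cube fun k => ?_)⟩
  · refine Metric.ball_subset_ball' ?_
    rw [dist_lineMap_left, Real.norm_of_nonneg ht0.le, dist_comm, dist_eq_norm]
    nlinarith [norm_cubeCenter_sub_le hx]
  · have h1 : (AffineMap.lineMap x (cubeCenter d) t : Config d) k =
        (1 - t) * x k + t * (1 / 2) := by
      simp [AffineMap.lineMap_apply_module, cubeCenter]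
    rw [h1]
    have := hx k
    constructor <;> nlinarith [this.1, this.2]

end Volume

namespace MultiRobotSystem

variable {R d : ℕ} {M : MultiRobotSystem R d}

lemma volume_free_ne_top (M : MultiRobotSystem R d) (i : Fin R) : volume (M.free i) ≠ ∞ :=
  ((measure_mono ((M.free_subset_cube i).trans cube_subset_closedBall)).trans_lt
    measure_closedBall_lt_top).ne

lemma HasClearance.toReal_volume_free_pos {δ : ℝ} (hδ : 0 < δ) {Q : Composite R d}
    (h : M.HasClearance δ Q) (i : Fin R) : 0 < (volume (M.free i)).toReal := by
  refine ENNReal.toReal_pos (fun h0 => ?_) (M.volume_free_ne_top i)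
  obtain ⟨y, hy⟩ := exists_ball_subset_ball_inter_cube (h.1 i) (lt_min hδ one_pos)
    (min_le_right _ _)
  have hsub : Metric.ball y (1 / (2 * (d + 1)) * min δ 1) ⊆ M.free i := fun q hq => by
    refine h.mem_free (hy hq).2 ?_
    have := mem_ball_iff_norm.1 (hy hq).1
    rw [norm_sub_rev]
    exact this.trans_le (min_le_left _ _)
  have : 0 < 1 / (2 * ((d : ℝ) + 1)) * min δ 1 := by positivity
  exact (Metric.measure_ball_pos volume y this).ne' (measure_mono_null hsub h0)

variable {Ω : Type*} [MeasurableSpace Ω] {P : Measure Ω}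
  {X : (n : ℕ) → Fin R → Fin n → Ω → Config d}

lemma IsUniformSampling.measurableSet_miss (hX : M.IsUniformSampling P X) (n : ℕ) (i : Fin R)
    {A : Set (Config d)} (hA : MeasurableSet A) : MeasurableSet {ω | ∀ k, X n i k ω ∉ A} := by
  simp only [ofPred_forall]
  exact MeasurableSet.iInter fun k => (hX.measurable n i k hA.compl)

variable [IsProbabilityMeasure P]

lemma IsUniformSampling.measure_miss_le (hX : M.IsUniformSampling P X) (n : ℕ) (i : Fin R)
    {A : Set (Config d)} (hA : MeasurableSet A) (hsub : A ⊆ M.free i) :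
    P {ω | ∀ k, X n i k ω ∉ A} ≤
      ENNReal.ofReal (Real.exp (-(n * ((volume A).toReal / (volume (M.free i)).toReal)))) := by
  by_cases h0 : volume (M.free i) = 0
  · simpa [h0] using prob_le_one
  have htop := M.volume_free_ne_top i
  set q := (volume A).toReal / (volume (M.free i)).toReal with hq
  have hk : ∀ k, P (X n i k ⁻¹' Aᶜ) ≤ ENNReal.ofReal (Real.exp (-q)) := fun k => by
    have h1 : P (X n i k ⁻¹' A) = volume A / volume (M.free i) := by
      rw [(hX.uniform n i k).measure_preimage h0 htop hA, inter_eq_right.2 hsub]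
    rw [preimage_compl, prob_compl_eq_one_sub (hX.measurable n i k hA), h1]
    have h2 : volume A / volume (M.free i) = ENNReal.ofReal q := by
      rw [hq, ← ENNReal.toReal_div, ENNReal.ofReal_toReal]
      exact ENNReal.div_ne_top (measure_ne_top_of_subset hsub htop) h0
    rw [h2, ← ENNReal.ofReal_one, ← ENNReal.ofReal_sub _ (by positivity)]
    exact ENNReal.ofReal_le_ofReal (Real.one_sub_le_exp_neg q)
  have hset : {ω | ∀ k, X n i k ω ∉ A} = ⋂ k ∈ (Finset.univ : Finset (Fin n)), X n i k ⁻¹' Aᶜ := by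
    ext ω; simp
  rw [hset, (hX.indep n i).measure_inter_preimage_eq_mul _ fun _ _ => hA.compl]
  refine (Finset.prod_le_prod' fun k _ => hk k).trans_eq ?_
  rw [Finset.prod_const, Finset.card_univ, Fintype.card_fin,
    ← ENNReal.ofReal_pow (Real.exp_nonneg _), ← Real.exp_nat_mul, mul_neg]

end MultiRobotSystem

/-! ### The connection radius -/

section Radius

variable {d : ℕ}

/-- The constant is chosen such that `n` samples miss a ball of radius
`γ (log n / n) ^ (1 / d) / (2 + η)` with probability at most `n ^ (-1 / d)`. -/
lemma log_div_le_of_radiusConstant_le (hd : 1 ≤ d) {η : ℝ} (hη : 0 < η) {A : Set (Config d)}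
    (hA : 0 < (volume A).toReal) {γ : ℝ} (hγ : radiusConstant η A ≤ γ) {n : ℕ} (hn : 1 ≤ n) :
    Real.log n / d ≤ n * ((γ * (Real.log n / n) ^ (1 / (d : ℝ)) / (2 + η)) ^ d *
      (volume (Metric.ball (0 : Config d) 1)).toReal / (volume A).toReal) := by
  set ζ := (volume (Metric.ball (0 : Config d) 1)).toReal with hζ
  have hζ0 : 0 < ζ := toReal_volume_unitBall_pos
  set μ := (volume A).toReal
  have hd0 : d ≠ 0 := by omega
  have hd' : (0 : ℝ) < d := by positivity
  have hn' : (0 : ℝ) < n := by positivity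
  have hlog : 0 ≤ Real.log n := Real.log_natCast_nonneg n
  have hroot : ∀ x : ℝ, 0 ≤ x → (x ^ (1 / (d : ℝ))) ^ d = x := fun x hx => by
    rw [one_div, Real.rpow_inv_natCast_pow hx hd0]
  have hrc : radiusConstant η A ^ d = ((1 + η) * 2) ^ d * (1 / d) * (μ / ζ) := by
    rw [radiusConstant, mul_pow, mul_pow _ ((1 / (d : ℝ)) ^ (1 / (d : ℝ))),
      hroot _ (by positivity), hroot _ (by positivity)]
  have hrc0 : 0 ≤ radiusConstant η A := by
    rw [radiusConstant]; positivity
  have hge : (2 + η) ^ d * ((1 / d) * (μ / ζ)) ≤ γ ^ d := by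
    calc (2 + η) ^ d * ((1 / d) * (μ / ζ)) ≤ ((1 + η) * 2) ^ d * ((1 / d) * (μ / ζ)) := by
          gcongr; linarith
      _ = radiusConstant η A ^ d := by rw [hrc]; ring
      _ ≤ γ ^ d := by gcongr
  have hq : 0 < (2 + η) ^ d := by positivity
  calc Real.log n / d
      = ((2 + η) ^ d * ((1 / d) * (μ / ζ))) * (Real.log n / (2 + η) ^ d * (ζ / μ)) := by
        field_simp
    _ ≤ γ ^ d * (Real.log n / (2 + η) ^ d * (ζ / μ)) := by gcongr
    _ = _ := by
        rw [div_pow, mul_pow, hroot _ (by positivity)]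
        field_simp

lemma radiusConstant_pos (hd : 1 ≤ d) {η : ℝ} (hη : 0 < η) {A : Set (Config d)}
    (hA : 0 < (volume A).toReal) : 0 < radiusConstant η A := by
  have := toReal_volume_unitBall_pos (d := d)
  have hd' : (0 : ℝ) < d := by positivity
  rw [radiusConstant]
  positivity

end Radius

namespace MultiRobotSystem

variable {R d : ℕ} {M : MultiRobotSystem R d}
  {Ω : Type*} [MeasurableSpace Ω] {P : Measure Ω} [IsProbabilityMeasure P]
  {X : (n : ℕ) → Fin R → Fin n → Ω → Config d}

/-- The probability of missing a set that contains a ball of `s` times the radius of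
`log_div_le_of_radiusConstant_le` is at most `n ^ (-s ^ d / d)`. -/
lemma IsUniformSampling.measure_miss_ball_le (hX : M.IsUniformSampling P X) (hd : 1 ≤ d) {η : ℝ}
    (hη : 0 < η) {i : Fin R} (hA : 0 < (volume (M.free i)).toReal) {γ : ℝ}
    (hγ : radiusConstant η (M.free i) ≤ γ) {n : ℕ} (hn : 1 ≤ n) {ρ : ℝ}
    (hρ : ρ = γ * (Real.log n / n) ^ (1 / (d : ℝ)) / (2 + η)) (hρ0 : 0 < ρ) {s : ℝ} (hs : 0 < s)
    {y : Config d} {B : Set (Config d)} (hyB : Metric.ball y (s * ρ) ⊆ B) (hB : B ⊆ M.free i) :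
    P {ω | ∀ k, X n i k ω ∉ B} ≤ ENNReal.ofReal (Real.exp (-(s ^ d * (Real.log n / d)))) := by
  have h1 : P {ω | ∀ k, X n i k ω ∉ B} ≤ P {ω | ∀ k, X n i k ω ∉ Metric.ball y (s * ρ)} :=
    measure_mono fun ω hω k hk => hω k (hyB hk)
  refine h1.trans ((hX.measure_miss_le n i Metric.isOpen_ball.measurableSet
    (hyB.trans hB)).trans (ENNReal.ofReal_le_ofReal (Real.exp_le_exp.2 (neg_le_neg ?_))))
  rw [toReal_volume_ball_config y (by positivity), mul_pow]
  calc s ^ d * (Real.log n / d) ≤ s ^ d * (n * (ρ ^ d *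
        (volume (Metric.ball (0 : Config d) 1)).toReal / (volume (M.free i)).toReal)) := by
        gcongr
        rw [hρ]
        exact log_div_le_of_radiusConstant_le hd hη hA hγ hn
    _ = _ := by ring

end MultiRobotSystem

/-! ### Asymptotics -/

section Asymptotics

lemma tendsto_log_div_rpow {d : ℕ} (hd : 1 ≤ d) :
    Tendsto (fun n : ℕ => (Real.log n / n) ^ (1 / (d : ℝ))) atTop (𝓝 0) := by
  have h1 : Tendsto (fun n : ℕ => Real.log n / n) atTop (𝓝 0) :=
    (Real.isLittleO_log_id_atTop.tendsto_div_nhds_zero).comp tendsto_natCast_atTop_atTop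
  have hd' : (0 : ℝ) < 1 / d := by positivity
  have h2 := h1.rpow_const (Or.inr hd'.le)
  rwa [Real.zero_rpow hd'.ne'] at h2

lemma tendsto_exp_neg_mul_log {d : ℕ} (hd : 1 ≤ d) {c : ℝ} (hc : 0 < c) :
    Tendsto (fun n : ℕ => Real.exp (-(c * (Real.log n / d)))) atTop (𝓝 0) := by
  have hd' : (0 : ℝ) < d := by positivity
  refine Real.tendsto_exp_neg_atTop_nhds_zero.comp ?_
  exact ((Real.tendsto_log_atTop.comp tendsto_natCast_atTop_atTop).atTop_div_const
    hd').const_mul_atTop hc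

/-- The logarithmic factor in the radius makes the number of balls smaller, by an unbounded factor,
than the inverse of the probability to miss one of them. -/
lemma tendsto_exp_neg_log_div_div {d : ℕ} (hd : 1 ≤ d) :
    Tendsto (fun n : ℕ => Real.exp (-(Real.log n / d)) / (Real.log n / n) ^ (1 / (d : ℝ)))
      atTop (𝓝 0) := by
  have hd' : (0 : ℝ) < 1 / d := by positivity
  have h1 : Tendsto (fun n : ℕ => ((Real.log n) ^ (1 / (d : ℝ)))⁻¹) atTop (𝓝 0) :=
    ((tendsto_rpow_atTop hd').comp
      (Real.tendsto_log_atTop.comp tendsto_natCast_atTop_atTop)).inv_tendsto_atTop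
  refine h1.congr' ?_
  filter_upwards [eventually_ge_atTop 2] with n hn
  have hn0 : (0 : ℝ) < n := by positivity
  have hlog : 0 < Real.log n := Real.log_pos (by exact_mod_cast hn)
  have hexp : Real.exp (-(Real.log n / d)) = ((n : ℝ) ^ (1 / (d : ℝ)))⁻¹ := by
    rw [Real.rpow_def_of_pos hn0, ← Real.exp_neg]
    congr 1; ring
  rw [hexp, Real.div_rpow hlog.le hn0.le]
  have : (0 : ℝ) < (n : ℝ) ^ (1 / (d : ℝ)) := by positivity
  have : (0 : ℝ) < (Real.log n) ^ (1 / (d : ℝ)) := by positivity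
  field_simp

lemma card_filter_near_ends_le (K J : ℕ) :
    ((Finset.range (K + 1)).filter fun j => j < J ∨ K - j < J).card ≤ 2 * J := by
  rw [Finset.filter_or]
  refine (Finset.card_union_le _ _).trans ?_
  rw [two_mul]
  refine add_le_add ?_ ?_
  · refine (Finset.card_le_card fun j hj => ?_).trans_eq (Finset.card_range J)
    exact Finset.mem_range.2 (Finset.mem_filter.1 hj).2
  · have h := Finset.card_le_card_of_injOn (s := (Finset.range (K + 1)).filter fun j => K - j < J)
      (t := Finset.range J) (fun j => K - j)
      (fun j hj => Finset.mem_coe.2 (Finset.mem_range.2 (Finset.mem_filter.1 hj).2))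
      (fun a ha b hb hab => by
        have h1 := Finset.mem_range.1 (Finset.mem_filter.1 ha).1
        have h2 := Finset.mem_range.1 (Finset.mem_filter.1 hb).1
        dsimp only at hab
        omega)
    rwa [Finset.card_range] at h

lemma asymptoticallyAlmostSurely_of_eventually {Ω : Type*} [MeasurableSpace Ω] {P : Measure Ω}
    [IsProbabilityMeasure P] {E : ℕ → Set Ω} {b : ℕ → ℝ} (hb : Tendsto b atTop (𝓝 0))
    (h : ∀ᶠ n in atTop, ∃ B : Set Ω, MeasurableSet B ∧ Bᶜ ⊆ E n ∧ P B ≤ ENNReal.ofReal (b n)) :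
    AsymptoticallyAlmostSurely P E := by
  classical
  have hchoice : ∀ n, ∃ A : Set Ω, MeasurableSet A ∧ A ⊆ E n ∧
      ((∃ B : Set Ω, MeasurableSet B ∧ Bᶜ ⊆ E n ∧ P B ≤ ENNReal.ofReal (b n)) →
        1 - ENNReal.ofReal (b n) ≤ P A) := fun n => by
    by_cases hB : ∃ B : Set Ω, MeasurableSet B ∧ Bᶜ ⊆ E n ∧ P B ≤ ENNReal.ofReal (b n)
    · obtain ⟨B, hBm, hBE, hBP⟩ := hB
      refine ⟨Bᶜ, hBm.compl, hBE, fun _ => ?_⟩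
      rw [prob_compl_eq_one_sub hBm]
      exact tsub_le_tsub_left hBP 1
    · exact ⟨∅, MeasurableSet.empty, empty_subset _, fun h' => absurd h' hB⟩
  choose A hA hAE hAP using hchoice
  refine ⟨A, hA, hAE, ?_⟩
  have hlim : Tendsto (fun n => 1 - ENNReal.ofReal (b n)) atTop (𝓝 1) := by
    have h1 := ENNReal.Tendsto.sub (tendsto_const_nhds (x := (1 : ℝ≥0∞)) (f := atTop))
      (ENNReal.tendsto_ofReal hb) (Or.inl ENNReal.one_ne_top)
    simpa using h1
  refine tendsto_of_tendsto_of_tendsto_of_le_of_le' hlim tendsto_const_nhds ?_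
    (Eventually.of_forall fun n => prob_le_one)
  filter_upwards [h] with n hn
  exact hAP n hn

lemma AsymptoticallyAlmostSurely.mono {Ω : Type*} [MeasurableSpace Ω] {P : Measure Ω}
    {E F : ℕ → Set Ω} (h : AsymptoticallyAlmostSurely P E) (hEF : ∀ n, E n ⊆ F n) :
    AsymptoticallyAlmostSurely P F := by
  obtain ⟨A, hA, hAE, hlim⟩ := h
  exact ⟨A, hA, fun n => (hAE n).trans (hEF n), hlim⟩

/-- Markov's inequality for the number of events that occur. -/
lemma measure_le_card_filter_mul_le {Ω ι : Type*} [MeasurableSpace Ω] {P : Measure Ω}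
    (s : Finset ι) {B : ι → Set Ω} [∀ ω, DecidablePred fun p => ω ∈ B p]
    (hB : ∀ p ∈ s, MeasurableSet (B p)) {q : ℝ≥0∞}
    (hq : ∀ p ∈ s, P (B p) ≤ q) (m : ℝ≥0∞) :
    MeasurableSet {ω | m ≤ ((s.filter fun p => ω ∈ B p).card : ℝ≥0∞)} ∧
      m * P {ω | m ≤ ((s.filter fun p => ω ∈ B p).card : ℝ≥0∞)} ≤ s.card * q := by
  classical
  have hcount : ∀ ω, ((s.filter fun p => ω ∈ B p).card : ℝ≥0∞) =
      ∑ p ∈ s, (B p).indicator (fun _ => (1 : ℝ≥0∞)) ω := fun ω => by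
    simp only [indicator_apply]
    rw [← Finset.sum_boole]
  have hmeas : Measurable fun ω => ∑ p ∈ s, (B p).indicator (fun _ => (1 : ℝ≥0∞)) ω :=
    Finset.measurable_sum _ fun p hp => measurable_const.indicator (hB p hp)
  simp only [hcount]
  refine ⟨measurableSet_le measurable_const hmeas, ?_⟩
  refine (mul_meas_ge_le_lintegral hmeas m).trans ?_
  rw [lintegral_finsetSum s fun p hp => measurable_const.indicator (hB p hp)]
  refine (Finset.sum_le_card_nsmul _ _ q fun p hp => ?_).trans_eq (nsmul_eq_mul _ _)
  rw [lintegral_indicator_const (hB p hp), one_mul]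
  exact hq p hp

end Asymptotics

/-! ### Random roadmaps contain short paths -/

namespace MultiRobotSystem

variable {R d : ℕ} {M : MultiRobotSystem R d} {S T : Composite R d}
  {Ω : Type*} [MeasurableSpace Ω] {P : Measure Ω} [IsProbabilityMeasure P]
  {X : (n : ℕ) → Fin R → Fin n → Ω → Config d}

open Classical in
/-- The samples satisfy the hypotheses of `exists_isRoadmapPath_of_samples` outside an event `B` of
small probability. The three terms of the bound stand for the balls of radius `ρ` inside the cube,
for the at most `2 J` balls per robot that stick out of it near the endpoints of the curve, and, by
Markov's inequality, for the number of empty balls of radius `β ρ`. The factor `1 / (2 (d + 1))` is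
that of `exists_ball_subset_ball_inter_cube`. -/
lemma IsRegularization.exists_bad_event {Sig : Path S T} {ε : ℝ}
    {f : ℝ → Composite R d} {Λ lam δ : ℝ} (h : M.IsRegularization Sig ε f Λ lam δ)
    (hX : M.IsUniformSampling P X) (hR : 1 ≤ R) (hd : 1 ≤ d) {η : ℝ} (hη : 0 < η) {γ : ℝ}
    (hγ : ∀ i, radiusConstant η (M.free i) ≤ γ) {n : ℕ} (hn : 1 ≤ n) {ρ : ℝ}
    (hρ : ρ = γ * (Real.log n / n) ^ (1 / (d : ℝ)) / (2 + η)) (hρ0 : 0 < ρ) (hρδ : ρ < δ)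
    (hρ1 : ρ ≤ 1) {β : ℝ} (hβ0 : 0 < β) (hβ1 : β ≤ 1) {K J : ℕ} (hK : 0 < K)
    (hJ : ρ * K ≤ lam * J) :
    ∃ B : Set Ω, MeasurableSet B ∧
      (∀ ω ∈ Bᶜ, (∀ j ≤ K, ∀ i, ∃ k, X n i k ω ∈ Metric.ball (f (j / K) i) ρ ∩ cube d) ∧
        ((((Finset.range (K + 1)) ×ˢ (Finset.univ : Finset (Fin R))).filter fun p =>
          ∀ k, X n p.2 k ω ∉ Metric.ball (f (p.1 / K) p.2) (β * ρ) ∩ cube d).card : ℝ) ≤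
            β * ((K + 1) * R)) ∧
      P B ≤ ENNReal.ofReal ((K + 1) * R * Real.exp (-(Real.log n / d)) +
        2 * J * R * Real.exp (-((1 / (2 * ((d : ℝ) + 1))) ^ d * (Real.log n / d))) +
        Real.exp (-((1 / (2 * ((d : ℝ) + 1)) * β) ^ d * (Real.log n / d))) / β) := by
  set κ : ℝ := 1 / (2 * ((d : ℝ) + 1)) with hκ
  have hκ0 : 0 < κ := by positivity
  have hRpos : (0 : ℝ) < R := by exact_mod_cast hR
  have hmemI : ∀ j ∈ Finset.range (K + 1), (j : ℝ) / K ∈ Icc (0 : ℝ) 1 := fun j hj =>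
    ⟨by positivity, div_le_one_of_le₀ (by exact_mod_cast Nat.lt_succ_iff.1 (Finset.mem_range.1 hj))
      (by positivity)⟩
  have hpos : ∀ i, 0 < (volume (M.free i)).toReal := fun i =>
    (h.clearance 0 (by simp)).toReal_volume_free_pos h.clearance_pos i
  have hfree : ∀ j ∈ Finset.range (K + 1), ∀ i, ∀ s ≤ ρ,
      Metric.ball (f (j / K) i) s ∩ cube d ⊆ M.free i := fun j hj i s hs q hq => by
    refine (h.clearance _ (hmemI j hj)).mem_free hq.2 ?_
    rw [norm_sub_rev]
    exact (mem_ball_iff_norm.1 hq.1).trans_le (hs.trans hρδ.le)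
  have hmeas : ∀ j i s, MeasurableSet {ω | ∀ k, X n i k ω ∉ Metric.ball (f (j / K) i) s ∩ cube d} :=
    fun j i s => hX.measurableSet_miss n i (Metric.isOpen_ball.measurableSet.inter
      measurableSet_cube)
  have hweak : ∀ j ∈ Finset.range (K + 1), ∀ i, ∀ s : ℝ, 0 < s → s ≤ 1 →
      P {ω | ∀ k, X n i k ω ∉ Metric.ball (f (j / K) i) (s * ρ) ∩ cube d} ≤
        ENNReal.ofReal (Real.exp (-((κ * s) ^ d * (Real.log n / d)))) := by
    intro j hj i s hs hs1
    have hsρ : s * ρ ≤ ρ := mul_le_of_le_one_left hρ0.le hs1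
    obtain ⟨y, hy⟩ := exists_ball_subset_ball_inter_cube ((h.clearance _ (hmemI j hj)).1 i)
      (mul_pos hs hρ0) (hsρ.trans hρ1)
    rw [← hκ, ← mul_assoc] at hy
    exact hX.measure_miss_ball_le hd hη (hpos i) (hγ i) hn hρ hρ0 (by positivity) hy
      (hfree j hj i _ hsρ)
  have hstrong : ∀ j ∈ Finset.range (K + 1), ¬ (j < J ∨ K - j < J) → ∀ i,
      P {ω | ∀ k, X n i k ω ∉ Metric.ball (f (j / K) i) ρ ∩ cube d} ≤
        ENNReal.ofReal (Real.exp (-(Real.log n / d))) := by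
    intro j hj hjJ i
    have hjK : j ≤ K := Nat.lt_succ_iff.1 (Finset.mem_range.1 hj)
    obtain ⟨h1, h2⟩ := not_or.1 hjJ
    have hin : ρ ≤ lam * min ((j : ℝ) / K) (1 - j / K) := by
      have hK' : (0 : ℝ) < K := by positivity
      have h1' : (J : ℝ) ≤ j := by exact_mod_cast not_lt.1 h1
      have h2' : (J : ℝ) ≤ K - j := by
        have : (J : ℝ) ≤ ((K - j : ℕ) : ℝ) := by exact_mod_cast not_lt.1 h2
        rwa [Nat.cast_sub hjK] at this
      have h3 : ρ ≤ lam * (J / K) := by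
        rw [← mul_div_assoc, le_div_iff₀ hK']
        exact hJ
      refine h3.trans (mul_le_mul_of_nonneg_left (le_min ?_ ?_) h.lam_pos.le)
      · gcongr
      · rw [one_sub_div hK'.ne']
        gcongr
    have hball : Metric.ball (f (j / K) i) (1 * ρ) ⊆ Metric.ball (f (j / K) i) ρ ∩ cube d := by
      rw [one_mul]
      refine subset_inter le_rfl (ball_subset_cube fun k => ?_)
      have := h.mem_Icc _ (hmemI j hj) i k
      exact ⟨hin.trans this.1, this.2.trans (by linarith)⟩
    have := hX.measure_miss_ball_le hd hη (hpos i) (hγ i) hn hρ hρ0 one_pos hball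
      (hfree j hj i _ le_rfl)
    simpa using this
  set big : ℕ → Fin R → Set Ω := fun j i =>
    {ω | ∀ k, X n i k ω ∉ Metric.ball (f (j / K) i) ρ ∩ cube d} with hbig
  set idx := (Finset.range (K + 1)) ×ˢ (Finset.univ : Finset (Fin R)) with hidx
  set small : ℕ × Fin R → Set Ω := fun p =>
    {ω | ∀ k, X n p.2 k ω ∉ Metric.ball (f (p.1 / K) p.2) (β * ρ) ∩ cube d} with hsmall
  set m : ℝ := β * ((K + 1) * R) with hm
  have hm0 : 0 < m := by positivity
  set q₁ := Real.exp (-(Real.log n / d)) with hq₁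
  set q₂ := Real.exp (-(κ ^ d * (Real.log n / d))) with hq₂
  set q₃ := Real.exp (-((κ * β) ^ d * (Real.log n / d))) with hq₃
  obtain ⟨hCm, hC⟩ := measure_le_card_filter_mul_le (P := P) idx (B := small)
    (q := ENNReal.ofReal q₃) (fun p _ => hmeas p.1 p.2 _)
    (fun p hp => hweak p.1 (Finset.mem_product.1 hp).1 p.2 β hβ0 hβ1) (ENNReal.ofReal m)
  set C := {ω | ENNReal.ofReal m ≤ ((idx.filter fun p => ω ∈ small p).card : ℝ≥0∞)}
  have hPC : P C ≤ ENNReal.ofReal (q₃ / β) := by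
    have hcard : (idx.card : ℝ≥0∞) * ENNReal.ofReal q₃ =
        ENNReal.ofReal m * ENNReal.ofReal (q₃ / β) := by
      rw [← ENNReal.ofReal_natCast, ← ENNReal.ofReal_mul (by positivity),
        ← ENNReal.ofReal_mul hm0.le]
      congr 1
      rw [hidx, hm]
      simp only [Finset.card_product, Finset.card_range, Finset.card_univ, Fintype.card_fin]
      push_cast
      field_simp
    rw [hcard] at hC
    exact (ENNReal.mul_le_mul_iff_right (ENNReal.ofReal_pos.2 hm0).ne' ENNReal.ofReal_ne_top).1 hC
  set D : Set Ω := ⋃ j ∈ Finset.range (K + 1), ⋃ i, big j i with hD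
  have hPD : P D ≤ ENNReal.ofReal ((K + 1) * R * q₁ + 2 * J * R * q₂) := by
    have hrow : ∀ j ∈ Finset.range (K + 1), P (⋃ i, big j i) ≤
        ENNReal.ofReal (R * q₁ + (if j < J ∨ K - j < J then R * q₂ else 0)) := by
      intro j hj
      refine (measure_iUnion_fintype_le P _).trans ?_
      have hone : ∀ i, P (big j i) ≤
          ENNReal.ofReal (q₁ + (if j < J ∨ K - j < J then q₂ else 0)) := fun i => by
        split_ifs with hjJ
        · have := hweak j hj i 1 one_pos le_rfl
          rw [one_mul, mul_one] at this
          refine this.trans (ENNReal.ofReal_le_ofReal ?_)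
          linarith [Real.exp_pos (-(Real.log n / d))]
        · rw [add_zero]
          exact hstrong j hj hjJ i
      refine (Finset.sum_le_card_nsmul _ _ _ fun i _ => hone i).trans_eq ?_
      rw [Finset.card_univ, Fintype.card_fin, nsmul_eq_mul, ← ENNReal.ofReal_natCast,
        ← ENNReal.ofReal_mul hRpos.le, mul_add, mul_ite, mul_zero]
    refine (measure_biUnion_finset_le _ _).trans ((Finset.sum_le_sum hrow).trans ?_)
    rw [← ENNReal.ofReal_sum_of_nonneg fun j _ => by positivity]
    refine ENNReal.ofReal_le_ofReal ?_
    rw [Finset.sum_add_distrib, ← Finset.sum_filter, Finset.sum_const, Finset.sum_const,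
      Finset.card_range, nsmul_eq_mul, nsmul_eq_mul]
    have hcard : ((((Finset.range (K + 1)).filter fun j => j < J ∨ K - j < J).card : ℕ) : ℝ) ≤
        2 * J := by
      exact_mod_cast card_filter_near_ends_le K J
    have h2 := mul_le_mul_of_nonneg_right hcard (by positivity : 0 ≤ R * q₂)
    push_cast
    linarith
  refine ⟨D ∪ C, ?_, ?_, ?_⟩
  · have hDm : MeasurableSet D := Finset.measurableSet_biUnion _ fun j _ =>
      MeasurableSet.iUnion fun i => hmeas j i ρ
    exact hDm.union hCm
  · intro ω hω
    rw [compl_union] at hω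
    refine ⟨fun j hj i => ?_, ?_⟩
    · by_contra hne
      refine hω.1 (mem_biUnion (Finset.mem_coe.2 (Finset.mem_range.2 (Nat.lt_succ_of_le hj))) ?_)
      exact mem_iUnion.2 ⟨i, not_exists.1 hne⟩
    · have hlt : ¬ ENNReal.ofReal m ≤ ((idx.filter fun p => ω ∈ small p).card : ℝ≥0∞) := hω.2
      rw [not_le] at hlt
      rw [← ENNReal.ofReal_natCast] at hlt
      exact ((ENNReal.ofReal_lt_ofReal_iff hm0).1 hlt).le
  · refine (measure_union_le _ _).trans ((add_le_add hPD hPC).trans_eq ?_)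
    rw [← ENNReal.ofReal_add (by positivity) (by positivity)]

/-- Asymptotically almost surely, the roadmap contains a collision-free path that is hardly longer
than a given regularized trajectory. -/
lemma IsRegularization.asymptoticallyAlmostSurely {Sig : Path S T} {ε : ℝ} (hε : 0 ≤ ε)
    {f : ℝ → Composite R d} {Λ lam δ : ℝ} (h : M.IsRegularization Sig ε f Λ lam δ)
    (hX : M.IsUniformSampling P X) (hR : 1 ≤ R) (hd : 1 ≤ d) {η : ℝ} (hη : 0 < η) {r : ℕ → ℝ}
    (hr : ∀ n : ℕ, 1 ≤ n → ∀ i : Fin R,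
      radiusConstant η (M.free i) * (Real.log n / n) ^ (1 / (d : ℝ)) ≤ r n)
    {e : ℝ} (he : 0 < e) :
    AsymptoticallyAlmostSurely P fun n => {ω | ∃ Sg : Path S T,
      M.IsRoadmapPath (fun i k => X n i k ω) (r n) Sg ∧
        arcLength Sg ≤ arcLength Sig + ENNReal.ofReal (ε + e) ∧
        ∀ i, arcLength (fun τ => Sg τ i) ≤
          arcLength (fun τ => Sig τ i) + ENNReal.ofReal (ε + e)} := by
  classical
  have : Nonempty (Fin R) := ⟨⟨0, hR⟩⟩
  have hRpos : (0 : ℝ) < R := by exact_mod_cast hR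
  have hΛ := h.lipschitz_pos
  have hlam := h.lam_pos
  obtain ⟨i₀, hi₀⟩ := Finite.exists_max fun i : Fin R => radiusConstant η (M.free i)
  set γ := radiusConstant η (M.free i₀)
  have hγ0 : 0 < γ := radiusConstant_pos hd hη
    ((h.clearance 0 (by simp)).toReal_volume_free_pos h.clearance_pos i₀)
  set L : ℕ → ℝ := fun n => (Real.log n / n) ^ (1 / (d : ℝ)) with hL
  have hL0 : Tendsto L atTop (𝓝 0) := tendsto_log_div_rpow hd
  set ρ : ℕ → ℝ := fun n => γ * L n / (2 + η) with hρ
  have hρ0 : Tendsto ρ atTop (𝓝 0) := by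
    simpa [hρ] using (hL0.const_mul γ).div_const (2 + η)
  set K : ℕ → ℕ := fun n => ⌈Λ / (η * ρ n)⌉₊ with hKdef
  -- an upper bound of `ρ n * (K n + 1)` as soon as `ρ n ≤ 1`
  set C : ℝ := Λ / η + 2 with hC
  have hC0 : 0 < C := by positivity
  set J : ℕ := ⌈C / lam⌉₊ with hJdef
  set β : ℝ := min 1 (e / (4 * C * R)) with hβ
  have hβ0 : 0 < β := by positivity
  set κ : ℝ := 1 / (2 * ((d : ℝ) + 1)) with hκ
  have hκ0 : 0 < κ := by positivity
  refine asymptoticallyAlmostSurely_of_eventually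
    (b := fun n => C * (2 + η) / γ * R * (Real.exp (-(Real.log n / d)) / L n) +
      2 * J * R * Real.exp (-(κ ^ d * (Real.log n / d))) +
      Real.exp (-((κ * β) ^ d * (Real.log n / d))) / β) ?_ ?_
  · have h1 := (tendsto_exp_neg_log_div_div hd).const_mul (C * (2 + η) / γ * R)
    have h2 := (tendsto_exp_neg_mul_log hd (by positivity : 0 < κ ^ d)).const_mul (2 * (J : ℝ) * R)
    have h3 := (tendsto_exp_neg_mul_log hd (by positivity : 0 < (κ * β) ^ d)).div_const β
    have h4 := (h1.add h2).add h3
    rw [mul_zero, mul_zero, zero_div, add_zero, add_zero] at h4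
    exact h4
  have hev1 : ∀ᶠ n in atTop, ρ n < min δ 1 :=
    hρ0.eventually_lt_const (lt_min h.clearance_pos one_pos)
  have hev2 : ∀ᶠ n in atTop, R * ((1 + η) * ρ n) < δ := by
    refine Tendsto.eventually_lt_const h.clearance_pos ?_
    simpa using (hρ0.const_mul (1 + η)).const_mul (R : ℝ)
  filter_upwards [hev1, hev2, eventually_ge_atTop 2] with n hn1 hn2 hn
  have hlog : 0 < Real.log n := Real.log_pos (by exact_mod_cast hn)
  have hnpos : (0 : ℝ) < n := by positivity
  have hLn : 0 < L n := by positivity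
  have hρn : 0 < ρ n := by positivity
  have hKn : 0 < K n := Nat.ceil_pos.2 (by positivity)
  have hKn' : (0 : ℝ) < K n := by exact_mod_cast hKn
  have hρ1 : ρ n ≤ 1 := (hn1.trans_le (min_le_right _ _)).le
  have hstep : Λ / K n ≤ η * ρ n := by
    rw [div_le_iff₀ hKn', ← div_le_iff₀' (by positivity)]
    exact Nat.le_ceil _
  have hKC : ρ n * (K n + 1) ≤ C := by
    have h1 : (K n : ℝ) < Λ / (η * ρ n) + 1 := Nat.ceil_lt_add_one (by positivity)
    calc ρ n * (K n + 1) ≤ ρ n * (Λ / (η * ρ n) + 1 + 1) := by gcongr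
      _ = Λ / η + 2 * ρ n := by field_simp; ring
      _ ≤ C := by rw [hC]; linarith
  have hJ : ρ n * K n ≤ lam * J := by
    have h1 : C ≤ lam * J := by
      rw [← div_le_iff₀' hlam]
      exact Nat.le_ceil _
    nlinarith
  obtain ⟨B, hBm, hB, hPB⟩ := h.exists_bad_event hX hR hd hη hi₀ (by omega : 1 ≤ n)
    (rfl : ρ n = γ * (Real.log n / n) ^ (1 / (d : ℝ)) / (2 + η)) hρn
    (hn1.trans_le (min_le_left _ _)) hρ1 hβ0 (min_le_left _ _) hKn hJ
  refine ⟨B, hBm, fun ω hω => ?_, hPB.trans (ENNReal.ofReal_le_ofReal ?_)⟩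
  · obtain ⟨hbig, hsmall⟩ := hB ω hω
    obtain ⟨Sg, hSg, h1, h2⟩ := h.exists_isRoadmapPath_of_samples hε
      (fun i k => X n i k ω) hKn hη.le hρn hstep (r := r n) (by
        have : (2 + η) * ρ n = γ * L n := by simp only [hρ]; field_simp
        rw [this]
        exact hr n (by omega) i₀) hn2 hβ0.le hbig hsmall
    have herr : 2 * ρ n * (β * ((K n + 1) * R) + β * ((K n + 1) * R)) ≤ e := by
      have hβe : β ≤ e / (4 * C * R) := min_le_right _ _
      calc 2 * ρ n * (β * ((K n + 1) * R) + β * ((K n + 1) * R))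
          = 4 * (ρ n * (K n + 1)) * R * β := by ring
        _ ≤ 4 * C * R * (e / (4 * C * R)) := by gcongr
        _ = e := by field_simp
    have hle := ENNReal.ofReal_le_ofReal (add_le_add (le_refl ε) herr)
    exact ⟨Sg, hSg, h1.trans (add_le_add le_rfl hle), fun i => (h2 i).trans (add_le_add le_rfl hle)⟩
  · have hK1 : (K n : ℝ) + 1 ≤ C * (2 + η) / γ / L n := by
      rw [div_div, le_div_iff₀ (by positivity)]
      have : (γ * L n) = ρ n * (2 + η) := by simp only [hρ]; field_simp
      rw [this]
      nlinarith
    gcongr ?_ + _ + _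
    calc ((K n : ℝ) + 1) * R * Real.exp (-(Real.log n / d))
        ≤ (C * (2 + η) / γ / L n) * R * Real.exp (-(Real.log n / d)) := by gcongr
      _ = _ := by ring

/-! ### Asymptotic optimality -/

lemma exists_isLowestCostPath_self {cost : (I → Composite R d) → ℝ≥0∞}
    (hcost : IsTrajectoryCost cost) (hS : S ∈ M.compositeFree) {n : ℕ}
    (x : Fin R → Fin n → Config d) (ρ : ℝ) :
    ∃ Sig : Path S S, M.IsLowestCostPath cost x ρ Sig ∧ cost Sig = 0 := by
  have hroad : M.IsRoadmapPath x ρ (Path.refl S) := by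
    have hvert : S ∈ tensorVertices S S x := fun i => Or.inl (Or.inl rfl)
    refine ⟨fun τ => hS, 1, fun _ => S, fun k => k, by simp, by simp, fun k _ =>
      ⟨by simp, ⟨hvert, hvert, fun i => Or.inl rfl⟩, fun τ _ _ => ?_⟩⟩
    simp
  have hzero : cost (Path.refl S) = 0 := by
    have hle : AddSubmonoid.closure (insert (arcLength (Path.refl S : I → Composite R d))
        (range fun i => arcLength fun τ => (Path.refl S : I → Composite R d) τ i)) ≤ ⊥ := by
      rw [AddSubmonoid.closure_le]
      rintro _ (rfl | ⟨i, rfl⟩)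
      · exact eVariationOn.constant_on <| by
          rintro _ ⟨_, _, rfl⟩ _ ⟨_, _, rfl⟩
          rfl
      · exact eVariationOn.constant_on <| by
          rintro _ ⟨_, _, rfl⟩ _ ⟨_, _, rfl⟩
          rfl
    exact AddSubmonoid.mem_bot.1 (hle (hcost.mem_closure (Path.refl S)))
  exact ⟨Path.refl S, ⟨hroad, fun Sig' _ => hzero ▸ zero_le⟩, hzero⟩

lemma edist_le_robustOptimum {cost : (I → Composite R d) → ℝ≥0∞} (hcost : IsTrajectoryCost cost)
    (i : Fin R) : edist (S i) (T i) ≤ M.robustOptimum cost S T := by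
  refine le_iInf₂ fun c hc => ?_
  have hlim : Tendsto (fun ε : ℝ => ENNReal.ofReal ((1 + ε) * c)) (𝓝[>] 0)
      (𝓝 (ENNReal.ofReal c)) := by
    have h1 : Continuous fun ε : ℝ => ENNReal.ofReal ((1 + ε) * c) :=
      ENNReal.continuous_ofReal.comp (by fun_prop)
    have h2 := (h1.tendsto 0).mono_left (nhdsWithin_le_nhds (s := Ioi 0))
    simpa using h2
  refine ge_of_tendsto hlim ?_
  filter_upwards [self_mem_nhdsWithin] with ε hε
  obtain ⟨Sig, -, hle⟩ := hc.2 ε hε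
  have := hcost.edist_le Sig i
  rw [Sig.source, Sig.target] at this
  exact this.trans hle

/-- Some robust trajectory stays below `(1 + ε) c*` by a positive margin `a`; the margin leaves room
for the excess cost of a roadmap path. -/
lemma exists_isRobust_cost_add_le {cost : (I → Composite R d) → ℝ≥0∞}
    (hcost : IsTrajectoryCost cost) (hfeasible : ∃ Sig : Path S T, M.IsRobust Sig) (hST : S ≠ T)
    {ε : ℝ} (hε : 0 < ε) :
    ∃ (Sig : Path S T) (a : ℝ), M.IsRobust Sig ∧ 0 < a ∧
      cost Sig + ENNReal.ofReal a ≤ ENNReal.ofReal (1 + ε) * M.robustOptimum cost S T := by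
  set c₀ := M.robustOptimum cost S T with hc₀
  by_cases htop : c₀ = ∞
  · obtain ⟨Sig, hSig⟩ := hfeasible
    refine ⟨Sig, 1, hSig, one_pos, ?_⟩
    rw [htop, ENNReal.mul_top (ENNReal.ofReal_pos.2 (by linarith)).ne']
    exact le_top
  have hpos : c₀ ≠ 0 := by
    obtain ⟨i, hi⟩ : ∃ i, S i ≠ T i := by
      by_contra! hne
      exact hST (PiLp.ext hne)
    exact ((edist_pos.2 hi).trans_le (edist_le_robustOptimum hcost i)).ne'
  have hc : 0 < c₀.toReal := ENNReal.toReal_pos hpos htop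
  -- `(1 + t) ^ 2 + t ≤ 1 + ε`
  set t : ℝ := min 1 (ε / 4) with ht
  have ht0 : 0 < t := by positivity
  have ht1 : t ≤ 1 := min_le_left _ _
  have ht2 : t ≤ ε / 4 := min_le_right _ _
  have hlt : c₀ < ENNReal.ofReal ((1 + t) * c₀.toReal) := by
    rw [ENNReal.lt_ofReal_iff_toReal_lt htop]
    nlinarith
  obtain ⟨c, hc', hclt⟩ : ∃ c, M.IsRobustValue cost S T c ∧
      ENNReal.ofReal c < ENNReal.ofReal ((1 + t) * c₀.toReal) := by
    rw [hc₀] at hlt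
    obtain ⟨c, hc⟩ := iInf_lt_iff.1 hlt
    obtain ⟨hc', hc⟩ := iInf_lt_iff.1 hc
    exact ⟨c, hc', hc⟩
  have hcR : c < (1 + t) * c₀.toReal := (ENNReal.ofReal_lt_ofReal_iff (by positivity)).1 hclt
  obtain ⟨Sig, hSig, hle⟩ := hc'.2 t ht0
  refine ⟨Sig, t * c₀.toReal, hSig, by positivity, ?_⟩
  calc cost Sig + ENNReal.ofReal (t * c₀.toReal)
      ≤ ENNReal.ofReal ((1 + t) * c) + ENNReal.ofReal (t * c₀.toReal) := add_le_add hle le_rfl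
    _ = ENNReal.ofReal ((1 + t) * c + t * c₀.toReal) :=
        (ENNReal.ofReal_add (mul_nonneg (by linarith) hc'.1.le) (by positivity)).symm
    _ ≤ ENNReal.ofReal ((1 + ε) * c₀.toReal) := by
        refine ENNReal.ofReal_le_ofReal ?_
        calc (1 + t) * c + t * c₀.toReal ≤ (1 + t) * ((1 + t) * c₀.toReal) + t * c₀.toReal := by
              gcongr
          _ = ((1 + t) * (1 + t) + t) * c₀.toReal := by ring
          _ ≤ (1 + ε) * c₀.toReal := mul_le_mul_of_nonneg_right (by nlinarith) hc.le
    _ = ENNReal.ofReal (1 + ε) * c₀ := by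
        rw [ENNReal.ofReal_mul (by linarith), ENNReal.ofReal_toReal htop]

lemma isAsymptoticallyOptimal (hR : 1 ≤ R) (hd : 1 ≤ d)
    {cost : (I → Composite R d) → ℝ≥0∞} (hcost : IsTrajectoryCost cost)
    (hfeasible : ∃ Sig : Path S T, M.IsRobust Sig)
    (hX : M.IsUniformSampling P X) {η : ℝ} (hη : 0 < η) {r : ℕ → ℝ}
    (hr : ∀ n : ℕ, 1 ≤ n → ∀ i : Fin R,
      radiusConstant η (M.free i) * (Real.log n / n) ^ (1 / (d : ℝ)) ≤ r n) :
    M.IsAsymptoticallyOptimal P X r S T cost := by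
  intro ε hε
  have hRpos : (0 : ℝ) < R := by exact_mod_cast hR
  by_cases hST : S = T
  · subst hST
    obtain ⟨Sig, hSig⟩ := hfeasible
    have hS : S ∈ M.compositeFree := by simpa using hSig.1 0
    refine ⟨fun _ => univ, fun _ => MeasurableSet.univ, fun n ω _ => ?_, by simp⟩
    obtain ⟨Sig', hlow, hzero⟩ := exists_isLowestCostPath_self (M := M) hcost hS
      (fun i k => X n i k ω) (r n)
    exact ⟨Sig', hlow, hzero ▸ zero_le⟩
  obtain ⟨Sig, a, hSig, ha, hle⟩ := exists_isRobust_cost_add_le hcost hfeasible hST hε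
  have he : 0 < a / (2 * R) := by positivity
  obtain ⟨f, Λ, lam, δ, hreg⟩ := hSig.exists_isRegularization he
  refine (hreg.asymptoticallyAlmostSurely he.le hX hR hd hη hr he).mono fun n ω => ?_
  rintro ⟨Sg, hSg, h1, h2⟩
  obtain ⟨Sig', hlow, hcost'⟩ := M.exists_isLowestCostPath hcost _ _ hSg
  refine ⟨Sig', hlow, hcost'.trans ((hcost.le_add Sg Sig _ h1 h2).trans (le_trans ?_ hle))⟩
  rw [← ENNReal.ofReal_natCast, ← ENNReal.ofReal_mul hRpos.le]
  refine add_le_add le_rfl (ENNReal.ofReal_le_ofReal (le_of_eq ?_))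
  field_simp
  norm_num

end MultiRobotSystem

theorem theorem1 {R d : ℕ} (hR : 2 ≤ R) (hd : 2 ≤ d) (M : MultiRobotSystem R d)
    (S T : Composite R d) (hfeasible : ∃ Sig : Path S T, M.IsRobust Sig)
    {Ω : Type*} [MeasurableSpace Ω] (P : Measure Ω) [IsProbabilityMeasure P]
    (X : (n : ℕ) → Fin R → Fin n → Ω → Config d) (hX : M.IsUniformSampling P X)
    (η : ℝ) (hη : 0 < η) (r : ℕ → ℝ)
    (hr : ∀ n : ℕ, 1 ≤ n → ∀ i : Fin R,
      radiusConstant η (M.free i) * (Real.log n / n) ^ (1 / (d : ℝ)) ≤ r n) :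
    M.IsAsymptoticallyOptimal P X r S T sumLengthCost ∧
      M.IsAsymptoticallyOptimal P X r S T maxLengthCost ∧
      M.IsAsymptoticallyOptimal P X r S T euclideanLengthCost := by
  have hR1 : 1 ≤ R := by omega
  have hd1 : 1 ≤ d := by omega
  exact ⟨MultiRobotSystem.isAsymptoticallyOptimal hR1 hd1 isTrajectoryCost_sumLengthCost
      hfeasible hX hη hr,
    MultiRobotSystem.isAsymptoticallyOptimal hR1 hd1 isTrajectoryCost_maxLengthCost
      hfeasible hX hη hr,
    MultiRobotSystem.isAsymptoticallyOptimal hR1 hd1 (isTrajectoryCost_euclideanLengthCost hR1)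
      hfeasible hX hη hr⟩
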